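/- For a metric space $(X,d)$ and a metric space $(Y,d')$, a map $\phi:X\to Y$ is a coarse embedding if there are functions $\rho_\pm:\mathbb{R}_{\ge 0}\to\mathbb{R}_{\ge 0}$ with $\rho_\pm(r)\to\infty$ as $r\to\infty$ and $\rho_-(d(x,y))\le d'(\phi(x),\phi(y))\le\rho_+(d(x,y))$ for all $x,y\in X$. For $1\le p<\infty$, the $\ell^p$ compression exponent $\alpha_p^*(X)$ is the supremum of all $\alpha\in[0,1]$ for which there are a constant $C>0$ and a coarse embedding $\phi:X\to\ell^p(\mathbb{N})$ with control functions satisfying $\rho_+(r)\le Cr+C$ and $\rho_-(r)\ge C^{-1}r^\alpha-C$ for all $r\ge 0$ (with $\sup\emptyset=0$). For a finitely generated group $G$, $\alpha_p^*(G)$ denotes the exponent of $G$ with the word metric of a finite generating set; it does not depend on the choice of this set. Let $G$ and $H$ be finitely generated groups and let $1\le p<\infty$. (i) Let $F$ be a finite group with injective homomorphisms $F\to G$ and $F\to H$, and let $G*_FH$ be the corresponding amalgamated product. Then $G*_FH$ is finitely generated and, for any choice of finite generating sets of the three groups, $\alpha_p^*(G*_FH)=\min\{\alpha_p^*(G),\alpha_p^*(H)\}$.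 (ii) Let $F$ be a finite subgroup of $G$, let $\theta$ be an isomorphism from $F$ onto a subgroup of $G$, and let $\mathrm{HNN}(G,F,\theta)=\langle G,t\mid tft^{-1}=\theta(f)\ (f\in F)\rangle$. Then $\mathrm{HNN}(G,F,\theta)$ is finitely generated and, for any choice of finite generating sets of the two groups, $\alpha_p^*(\mathrm{HNN}(G,F,\theta))=\alpha_p^*(G)$. -/

import Mathlib

open scoped NNReal ENNReal
open Filter

universe u v w

/-- The map `φ : X → Y` is a coarse embedding of `(X, dX)` into the metric space `Y` with lower
control function `ρm` and upper control function `ρp`. -/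
structure IsCoarseEmbeddingWith {X : Type u} {Y : Type v} [MetricSpace Y] (dX : X → X → ℝ≥0)
    (φ : X → Y) (ρm ρp : ℝ≥0 → ℝ≥0) : Prop where
  tendsto_lower : Tendsto ρm atTop atTop
  tendsto_upper : Tendsto ρp atTop atTop
  lower : ∀ x y : X, ρm (dX x y) ≤ nndist (φ x) (φ y)
  upper : ∀ x y : X, nndist (φ x) (φ y) ≤ ρp (dX x y)

/-- The set of `α ∈ [0,1]` such that `(X, dX)` admits a coarse embedding into `Y` with
`ρ₊(r) ≤ C r + C` and `ρ₋(r) ≥ C⁻¹ r ^ α - C` for some constant `C > 0`. -/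
def compressionSet {X : Type u} (dX : X → X → ℝ≥0) (Y : Type v) [MetricSpace Y] : Set ℝ :=
  {α | α ∈ Set.Icc (0 : ℝ) 1 ∧
    ∃ (φ : X → Y) (ρm ρp : ℝ≥0 → ℝ≥0) (C : ℝ), 0 < C ∧ IsCoarseEmbeddingWith dX φ ρm ρp ∧
      (∀ r : ℝ≥0, (ρp r : ℝ) ≤ C * (r : ℝ) + C) ∧
      (∀ r : ℝ≥0, C⁻¹ * (r : ℝ) ^ α - C ≤ (ρm r : ℝ))}

/-- The compression exponent of `(X, dX)` in `Y`. It is `0` if there is no coarse embedding as in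
`compressionSet`, since in Mathlib the supremum of the empty set of reals is `0`. -/
noncomputable def compressionExponent {X : Type u} (dX : X → X → ℝ≥0) (Y : Type v)
    [MetricSpace Y] : ℝ :=
  sSup (compressionSet dX Y)

/-- The word metric on the group `G` with respect to the set `S`: the path metric on the vertices
of the Cayley graph, in which `g` and `g * s` are joined for `s ∈ S`. -/
noncomputable def wordDist {G : Type u} [Group G] (S : Set G) (g h : G) : ℝ≥0 :=
  ((SimpleGraph.mulCayley S).dist g h : ℝ≥0)

/-- The `ℓ^p` compression exponent of the group `G` with the word metric of the generating
set `S`, the target being the real sequence space `ℓ^p(ℕ)`. -/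
noncomputable def lpCompressionExponent (p : ℝ≥0∞) [Fact (1 ≤ p)] {G : Type u} [Group G]
    (S : Set G) : ℝ :=
  compressionExponent (wordDist S) (lp (fun _ : ℕ => ℝ) p)

/-- `S` is a finite generating set of the group `G`. -/
def IsFiniteGenerating {G : Type u} [Group G] (S : Set G) : Prop :=
  S.Finite ∧ Subgroup.closure S = ⊤

/-- The two factors of an amalgamated product, as a family indexed by `Bool`. -/
def AmalgFactor (G H : Type u) : Bool → Type u
  | true => G
  | false => H

instance AmalgFactor.instGroup (G H : Type u) [Group G] [Group H] :
    ∀ b : Bool, Group (AmalgFactor G H b)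
  | true => inferInstanceAs (Group G)
  | false => inferInstanceAs (Group H)

/-- The two homomorphisms `i : F → G` and `j : F → H`, as a family indexed by `Bool`. -/
def amalgMap {G H : Type u} {F : Type v} [Group G] [Group H] [Group F] (i : F →* G) (j : F →* H) :
    ∀ b : Bool, F →* AmalgFactor G H b
  | true => i
  | false => j

/-- The amalgamated product `G *_F H` along `i : F → G` and `j : F → H` (to be used for
injective `i` and `j`): the pushout of `i` and `j` in the category of groups. -/
abbrev AmalgamatedProduct {G H : Type u} {F : Type v} [Group G] [Group H] [Group F]
    (i : F →* G) (j : F →* H) : Type (max u v) :=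
  Monoid.PushoutI (amalgMap i j)

/-! ### Real powers -/

/-! The factors sit undistorted in the amalgam or HNN extension, and conversely embeddings of the
factors can be assembled along the Bass–Serre tree.

Both constructions have normal forms, lists of letters, for which left multiplication by a generator
changes only the beginning of the list, by at most two moves of bounded size (`ListMove`). Since the
edges of the Cayley graph are `g`, `g * s`, it is the normal form of `g⁻¹` that varies in this way.

Upper bound: sending a list to its last letter is a Lipschitz map onto a factor which moves the
elements of the factor by a bounded amount (`exists_wordNorm_le_of_normalForm`). So the factors are
undistorted, and embeddings of the large group restrict to them.

Lower bound: let `γ < 1` be a compression attained by the factors. Two lists that branch after a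
longest common suffix `r` have the form `u ++ a :: r` and `v ++ b :: r` with `a ≠ b`. The distance
of the two elements is, up to constants, at most the length of `u` plus the distance of `a` and `b`
plus the length of `v`, so it suffices to control the largest of the three. The embedding has two
summands. `blockVec` uses a separate copy of the embedding of the letters for every `r`, and so
detects the distance of `a` and `b`. `treeVec` records the path from the root to the list, weighted
by the distance from its tip, and so detects the lengths of `u` and `v`. The weights `(i + 1) ^ s`
grow fast enough for compression `γ`, while their increments are `q`-summable, which makes the path
map Lipschitz (`exists_tree_weights`). The two summands are combined in
`hasCompression_of_normalForm`. Losing the exponent `γ = 1` is harmless because the compression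
exponent is a supremum. -/

lemma rpow_le_of_le_affine {d M K γ : ℝ} (hd : 0 ≤ d) (hM : 0 ≤ M) (hK : 1 ≤ K) (hγ : 0 ≤ γ)
    (hγ1 : γ ≤ 1) (h : d ≤ K * M + K) : d ^ γ ≤ K * M ^ γ + K := by
  have hK0 : 0 ≤ K := zero_le_one.trans hK
  have hKγ : K ^ γ ≤ K := by
    simpa using Real.rpow_le_rpow_of_exponent_le hK hγ1
  calc d ^ γ ≤ (K * M + K) ^ γ := Real.rpow_le_rpow hd h hγ
    _ ≤ (K * M) ^ γ + K ^ γ := Real.rpow_add_le_add_rpow (by positivity) hK0 hγ hγ1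
    _ = K ^ γ * M ^ γ + K ^ γ := by rw [Real.mul_rpow hK0 hM]
    _ ≤ K * M ^ γ + K := by gcongr

lemma rpow_le_rpow_add_one {d γ γ' : ℝ} (hd : 0 ≤ d) (hγ : 0 ≤ γ) (h : γ ≤ γ') :
    d ^ γ ≤ d ^ γ' + 1 := by
  rcases le_total d 1 with h1 | h1
  · have := Real.rpow_le_one hd h1 hγ
    have := Real.rpow_nonneg hd γ'
    linarith
  · have := Real.rpow_le_rpow_of_exponent_le h1 h
    linarith

/-! ### Compression exponents -/

/-- There is a large scale Lipschitz map to `Y` with lower control function of order `r ^ α`. -/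
def HasCompression {X : Type u} (dX : X → X → ℝ≥0) (Y : Type v) [MetricSpace Y] (α : ℝ) : Prop :=
  ∃ (φ : X → Y) (K : ℝ), 1 ≤ K ∧ ∀ x y, dist (φ x) (φ y) ≤ K * dX x y + K ∧
    (dX x y : ℝ) ^ α ≤ K * dist (φ x) (φ y) + K

lemma HasCompression.of_mem {X : Type u} {dX : X → X → ℝ≥0} {Y : Type v} [MetricSpace Y] {α : ℝ}
    (h : α ∈ compressionSet dX Y) : HasCompression dX Y α := by
  obtain ⟨-, φ, ρm, ρp, C, hC, hφ, hp, hm⟩ := h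
  refine ⟨φ, 1 + C + C ^ 2, by nlinarith, fun x y => ⟨?_, ?_⟩⟩
  · have h1 : dist (φ x) (φ y) ≤ ρp (dX x y) := by exact_mod_cast hφ.upper x y
    have h2 := hp (dX x y)
    have h3 : (0 : ℝ) ≤ dX x y := NNReal.coe_nonneg _
    nlinarith [mul_nonneg (by positivity : 0 ≤ 1 + C ^ 2) h3]
  · have h1 : (ρm (dX x y) : ℝ) ≤ dist (φ x) (φ y) := by exact_mod_cast hφ.lower x y
    have h2 := (hm (dX x y)).trans h1
    have h3 : (dX x y : ℝ) ^ α = C * (C⁻¹ * (dX x y : ℝ) ^ α) := by field_simp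
    have h4 : C * (C⁻¹ * (dX x y : ℝ) ^ α) ≤ C * (dist (φ x) (φ y) + C) := by
      apply mul_le_mul_of_nonneg_left _ hC.le
      linarith
    have h5 : 0 ≤ dist (φ x) (φ y) := dist_nonneg
    nlinarith [mul_nonneg (by positivity : 0 ≤ 1 + C ^ 2) h5]

/-- Truncated affine and power functions serve as control functions; the lower one tends to infinity
only for `0 < α`. Excluding `α = 0` costs nothing, as the compression exponent is nonnegative in any
case. -/
lemma HasCompression.mem {X : Type u} {dX : X → X → ℝ≥0} {Y : Type v} [MetricSpace Y] {α : ℝ}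
    (h : HasCompression dX Y α) (h0 : 0 < α) (h1 : α ≤ 1) : α ∈ compressionSet dX Y := by
  obtain ⟨φ, K, hK, hφ⟩ := h
  have hK0 : 0 < K := zero_lt_one.trans_le hK
  refine ⟨⟨h0.le, h1⟩, φ, fun r => (K⁻¹ * (r : ℝ) ^ α - K).toNNReal,
    fun r => (K * r + K).toNNReal, K, hK0, ⟨?_, ?_, fun x y => ?_, fun x y => ?_⟩,
    fun r => ?_, fun r => Real.le_coe_toNNReal _⟩
  · refine tendsto_real_toNNReal_atTop.comp (tendsto_atTop_add_const_right _ _ ?_)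
    exact ((tendsto_rpow_atTop h0).comp
      (NNReal.tendsto_coe_atTop.2 tendsto_id)).const_mul_atTop (inv_pos.2 hK0)
  · refine tendsto_real_toNNReal_atTop.comp (tendsto_atTop_add_const_right _ _ ?_)
    exact (NNReal.tendsto_coe_atTop.2 tendsto_id).const_mul_atTop hK0
  · rw [← NNReal.coe_le_coe, coe_nndist, Real.coe_toNNReal', max_le_iff]
    refine ⟨?_, dist_nonneg⟩
    rw [sub_le_iff_le_add, inv_mul_le_iff₀ hK0]
    nlinarith [(hφ x y).2]
  · rw [← NNReal.coe_le_coe, coe_nndist, Real.coe_toNNReal']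
    exact (hφ x y).1.trans (le_max_left _ _)
  · rw [Real.coe_toNNReal _ (by positivity)]

lemma HasCompression.mono {X : Type u} {dX : X → X → ℝ≥0} {Y : Type v} [MetricSpace Y] {α β : ℝ}
    (h : HasCompression dX Y α) (h0 : 0 ≤ β) (h1 : β ≤ α) : HasCompression dX Y β := by
  obtain ⟨φ, K, hK, hφ⟩ := h
  refine ⟨φ, K + 1, by linarith, fun x y => ⟨?_, ?_⟩⟩
  · have h3 : (0 : ℝ) ≤ dX x y := NNReal.coe_nonneg _
    nlinarith [(hφ x y).1]
  · have := rpow_le_rpow_add_one (NNReal.coe_nonneg (dX x y)) h0 h1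
    nlinarith [(hφ x y).2, dist_nonneg (x := φ x) (y := φ y)]

/-- Compression pulls back along quasi-isometric embeddings: for `0 ≤ α ≤ 1` subadditivity of `r ^
α` turns an affine bound on distances into one on their powers. -/
lemma HasCompression.comap {X : Type u} {X' : Type w} {dX : X → X → ℝ≥0} {dX' : X' → X' → ℝ≥0}
    {Y : Type v} [MetricSpace Y] {α : ℝ} (h0 : 0 ≤ α) (h1 : α ≤ 1) (f : X → X') {K : ℝ}
    (hK : 1 ≤ K) (hf : ∀ x y, (dX' (f x) (f y) : ℝ) ≤ K * dX x y + K)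
    (hf' : ∀ x y, (dX x y : ℝ) ≤ K * dX' (f x) (f y) + K)
    (h : HasCompression dX' Y α) : HasCompression dX Y α := by
  obtain ⟨φ, C, hC, hφ⟩ := h
  have hKC : 0 ≤ K * C := by positivity
  refine ⟨φ ∘ f, 2 * K * C + K + C, by linarith, fun x y => ⟨?_, ?_⟩⟩
  · refine (hφ (f x) (f y)).1.trans ?_
    have h3 : (0 : ℝ) ≤ dX x y := NNReal.coe_nonneg _
    have := mul_le_mul_of_nonneg_left (hf x y) (zero_le_one.trans hC)
    nlinarith [mul_nonneg hKC h3]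
  · have h2 := rpow_le_of_le_affine (NNReal.coe_nonneg _) (NNReal.coe_nonneg _) hK h0 h1 (hf' x y)
    have h4 := mul_le_mul_of_nonneg_left (hφ (f x) (f y)).2 (zero_le_one.trans hK)
    have h5 : 0 ≤ dist (φ (f x)) (φ (f y)) := dist_nonneg
    simp only [Function.comp]
    nlinarith [mul_nonneg hKC h5]

lemma bddAbove_compressionSet {X : Type u} (dX : X → X → ℝ≥0) (Y : Type v) [MetricSpace Y] :
    BddAbove (compressionSet dX Y) :=
  ⟨1, fun _ h => h.1.2⟩

lemma compressionExponent_nonneg {X : Type u} (dX : X → X → ℝ≥0) (Y : Type v) [MetricSpace Y] :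
    0 ≤ compressionExponent dX Y :=
  Real.sSup_nonneg fun _ h => h.1.1

lemma compressionExponent_le {X : Type u} {dX : X → X → ℝ≥0} {Y : Type v} [MetricSpace Y] {c : ℝ}
    (hc : 0 ≤ c) (h : ∀ α, 0 < α → α ≤ 1 → HasCompression dX Y α → α ≤ c) :
    compressionExponent dX Y ≤ c := by
  refine Real.sSup_le (fun α hα => ?_) hc
  rcases hα.1.1.eq_or_lt with h0 | h0
  · exact h0 ▸ hc
  · exact h α h0 hα.1.2 (.of_mem hα)

lemma HasCompression.le_compressionExponent {X : Type u} {dX : X → X → ℝ≥0} {Y : Type v}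
    [MetricSpace Y] {α : ℝ} (h : HasCompression dX Y α) (h0 : 0 < α) (h1 : α ≤ 1) :
    α ≤ compressionExponent dX Y :=
  le_csSup (bddAbove_compressionSet _ _) (h.mem h0 h1)

lemma HasCompression.of_lt_compressionExponent {X : Type u} {dX : X → X → ℝ≥0} {Y : Type v}
    [MetricSpace Y] {α : ℝ} (h0 : 0 ≤ α) (h : α < compressionExponent dX Y) :
    HasCompression dX Y α := by
  have hne : (compressionSet dX Y).Nonempty := by
    by_contra hne
    rw [Set.not_nonempty_iff_eq_empty] at hne
    rw [compressionExponent, hne, Real.sSup_empty] at h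
    linarith
  obtain ⟨β, hβ, hαβ⟩ := exists_lt_of_lt_csSup hne h
  exact (HasCompression.of_mem hβ).mono h0 hαβ.le

lemma compressionExponent_le_one {X : Type u} (dX : X → X → ℝ≥0) (Y : Type v) [MetricSpace Y] :
    compressionExponent dX Y ≤ 1 :=
  Real.sSup_le (fun _ h => h.1.2) zero_le_one

lemma compressionExponent_mono {X : Type u} {X' : Type w} {dX : X → X → ℝ≥0}
    {dX' : X' → X' → ℝ≥0} {Y : Type v} [MetricSpace Y] (f : X → X') {K : ℝ}
    (hK : 1 ≤ K) (hf : ∀ x y, (dX' (f x) (f y) : ℝ) ≤ K * dX x y + K)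
    (hf' : ∀ x y, (dX x y : ℝ) ≤ K * dX' (f x) (f y) + K) :
    compressionExponent dX' Y ≤ compressionExponent dX Y :=
  compressionExponent_le (compressionExponent_nonneg _ _) fun _ h0 h1 h =>
    (h.comap h0.le h1 f hK hf hf').le_compressionExponent h0 h1

/-! ### Word metrics -/

/-- The word length of `g` with respect to `S`. -/
noncomputable def wordNorm {G : Type u} [Group G] (S : Set G) (g : G) : ℝ := wordDist S 1 g

section WordNorm

variable {G : Type u} [Group G] {S : Set G}

lemma wordNorm_nonneg (g : G) : 0 ≤ wordNorm S g := NNReal.coe_nonneg _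

lemma wordNorm_one : wordNorm S (1 : G) = 0 := by simp [wordNorm, wordDist]

lemma mulCayley_dist_mul_left_le (hS : (SimpleGraph.mulCayley S).Connected) (a g h : G) :
    (SimpleGraph.mulCayley S).dist (a * g) (a * h) ≤ (SimpleGraph.mulCayley S).dist g h := by
  obtain ⟨w, hw⟩ := hS.exists_walk_length_eq_dist g h
  let f : SimpleGraph.mulCayley S →g SimpleGraph.mulCayley S :=
    ⟨fun x => a * x, fun h => SimpleGraph.mulCayley_adj_mul_iff_right.2 h⟩
  rw [← hw, ← SimpleGraph.Walk.length_map f w]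
  exact SimpleGraph.dist_le _

lemma mulCayley_connected (hS : Subgroup.closure S = ⊤) : (SimpleGraph.mulCayley S).Connected := by
  have key : ∀ g : G, ∀ a : G, (SimpleGraph.mulCayley S).Reachable a (a * g) := by
    intro g
    have hg : g ∈ Subgroup.closure S := hS ▸ Subgroup.mem_top g
    induction hg using Subgroup.closure_induction with
    | mem x hx =>
      intro a
      by_cases h : a = a * x
      · rw [← h]
      · refine SimpleGraph.Adj.reachable ?_
        rw [SimpleGraph.mulCayley_adj]
        exact ⟨h, .inl (by simpa using hx)⟩
    | one => intro a; simp
    | mul x y _ _ hx hy =>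
      intro a
      have := (hx a).trans (hy (a * x))
      rwa [mul_assoc] at this
    | inv x _ hx =>
      intro a
      simpa using (hx (a * x⁻¹)).symm
  have : Nonempty G := ⟨1⟩
  exact ⟨fun g h => by simpa using key (g⁻¹ * h) g⟩

lemma wordDist_eq_wordNorm (hS : Subgroup.closure S = ⊤) (g h : G) :
    (wordDist S g h : ℝ) = wordNorm S (g⁻¹ * h) := by
  have hc := mulCayley_connected hS
  simp only [wordNorm, wordDist, NNReal.coe_natCast, Nat.cast_inj]
  apply le_antisymm
  · simpa using mulCayley_dist_mul_left_le hc g 1 (g⁻¹ * h)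
  · simpa using mulCayley_dist_mul_left_le hc g⁻¹ g h

lemma wordNorm_inv (hS : Subgroup.closure S = ⊤) (g : G) : wordNorm S g⁻¹ = wordNorm S g := by
  have := wordDist_eq_wordNorm hS g 1
  rw [mul_one] at this
  rw [← this, wordNorm, wordDist, wordDist, SimpleGraph.dist_comm]

lemma wordNorm_mul_le (hS : Subgroup.closure S = ⊤) (g h : G) :
    wordNorm S (g * h) ≤ wordNorm S g + wordNorm S h := by
  have h1 := (mulCayley_connected hS).dist_triangle (u := 1) (v := g) (w := g * h)
  have h2 := wordDist_eq_wordNorm hS g (g * h)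
  rw [inv_mul_cancel_left] at h2
  rw [← h2]
  simp only [wordNorm, wordDist, NNReal.coe_natCast]
  exact_mod_cast h1

/-- A subadditive quantity on pairs bounded along the generators is Lipschitz for the word
metric. -/
lemma le_mul_wordDist (hS : Subgroup.closure S = ⊤) (D : G → G → ℝ) {K : ℝ} (h0 : ∀ g, D g g ≤ 0)
    (hsymm : ∀ g h, D g h = D h g)
    (htri : ∀ a b c, D a c ≤ D a b + D b c) (hD : ∀ g, ∀ s ∈ S, D g (g * s) ≤ K) (g h : G) :
    D g h ≤ K * wordDist S g h := by
  obtain ⟨w, hw⟩ := (mulCayley_connected hS).exists_walk_length_eq_dist g h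
  rw [wordDist, ← hw]
  clear hw
  induction w with
  | nil => simpa using h0 _
  | @cons a b c hab w ih =>
    have h1 : D a b ≤ K := by
      rw [SimpleGraph.mulCayley_adj'] at hab
      obtain ⟨-, s, hs, rfl | rfl⟩ := hab
      · exact hD _ s hs
      · rw [hsymm]; exact hD _ s hs
    have := htri a b c
    simp only [SimpleGraph.Walk.length_cons, Nat.cast_add, Nat.cast_one, NNReal.coe_add,
      NNReal.coe_natCast, NNReal.coe_one] at ih ⊢
    linarith

lemma exists_wordNorm_map_le {Γ : Type v} [Group Γ] {T : Set Γ} (hS : IsFiniteGenerating S)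
    (hT : Subgroup.closure T = ⊤) (f : G →* Γ) :
    ∃ K : ℝ, 1 ≤ K ∧ ∀ g, wordNorm T (f g) ≤ K * wordNorm S g := by
  obtain ⟨K, hK⟩ := (hS.1.image fun s => wordNorm T (f s)).bddAbove
  refine ⟨max K 1, le_max_right _ _, fun g => ?_⟩
  have h := le_mul_wordDist hS.2 (fun a b => wordNorm T (f (a⁻¹ * b))) (K := max K 1)
    (fun g => by simp [wordNorm_one])
    (fun g h => by rw [← wordNorm_inv hT, ← map_inv]; simp)
    (fun a b c => by
      have := wordNorm_mul_le hT (f (a⁻¹ * b)) (f (b⁻¹ * c))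
      rwa [← map_mul, show a⁻¹ * b * (b⁻¹ * c) = a⁻¹ * c by group] at this)
    (fun g s hs => by
      simpa using Or.inl (hK ⟨s, hs, rfl⟩)) 1 g
  change _ ≤ _ * (wordDist S 1 g : ℝ)
  simpa using h

lemma lpCompressionExponent_eq (p : ℝ≥0∞) [Fact (1 ≤ p)] {T : Set G} (hS : IsFiniteGenerating S)
    (hT : IsFiniteGenerating T) : lpCompressionExponent p S = lpCompressionExponent p T := by
  have key : ∀ {S T : Set G}, IsFiniteGenerating S → IsFiniteGenerating T →
      lpCompressionExponent p S ≤ lpCompressionExponent p T := by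
    intro S T hS hT
    obtain ⟨K, hK, h⟩ := exists_wordNorm_map_le hS hT.2 (MonoidHom.id G)
    obtain ⟨K', hK', h'⟩ := exists_wordNorm_map_le hT hS.2 (MonoidHom.id G)
    refine compressionExponent_mono id (K := K + K') (by linarith) (fun x y => ?_) (fun x y => ?_)
    · rw [id, id, wordDist_eq_wordNorm hS.2, wordDist_eq_wordNorm hT.2]
      have := h' (x⁻¹ * y)
      have := wordNorm_nonneg (S := T) (x⁻¹ * y)
      simp only [MonoidHom.id_apply] at *
      nlinarith
    · rw [id, id, wordDist_eq_wordNorm hS.2, wordDist_eq_wordNorm hT.2]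
      have := h (x⁻¹ * y)
      have := wordNorm_nonneg (S := S) (x⁻¹ * y)
      simp only [MonoidHom.id_apply] at *
      nlinarith
  exact le_antisymm (key hS hT) (key hT hS)

end WordNorm

/-! ### Reindexing `ℓ^p` spaces -/

section Reindex

variable {ι : Type u} {κ : Type v} {p : ℝ≥0∞}

lemma toReal_pos_of_one_le [Fact (1 ≤ p)] (hp : p ≠ ∞) : 0 < p.toReal :=
  ENNReal.toReal_pos (zero_lt_one.trans_le Fact.out).ne' hp

lemma norm_extend_zero_rpow {q : ℝ} (hq : 0 < q) (e : ι ↪ κ) (f : ι → ℝ) :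
    (fun k => ‖Function.extend e f 0 k‖ ^ q) = Function.extend e (fun i => ‖f i‖ ^ q) 0 := by
  funext k
  by_cases hk : ∃ i, e i = k
  · obtain ⟨i, rfl⟩ := hk
    simp [e.injective.extend_apply]
  · simp [Function.extend_apply' _ _ _ hk, Real.zero_rpow hq.ne']

lemma memℓp_extend_zero [Fact (1 ≤ p)] (hp : p ≠ ∞) (e : ι ↪ κ) {f : ι → ℝ} (hf : Memℓp f p) :
    Memℓp (Function.extend e f 0) p := by
  refine memℓp_gen ?_
  rw [norm_extend_zero_rpow (toReal_pos_of_one_le hp)]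
  refine (e.injective.summable_iff fun k hk => ?_).1 ?_
  · exact Function.extend_apply' _ _ _ hk
  · rw [Function.extend_comp e.injective]
    exact hf.summable (toReal_pos_of_one_le hp)

lemma lp_sum_apply {A : Type w} (s : Finset A) (F : A → lp (fun _ : ι => ℝ) p) (i : ι) :
    (∑ a ∈ s, F a) i = ∑ a ∈ s, F a i :=
  (congrFun (lp.coeFn_sum F s) i).trans (Finset.sum_apply i s fun a => (F a : ι → ℝ))

lemma lp_sub_apply (f g : lp (fun _ : ι => ℝ) p) (i : ι) : (f - g) i = f i - g i := rfl

lemma lp_single_apply [DecidableEq ι] (i j : ι) (a : ℝ) :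
    (lp.single p i a : lp (fun _ : ι => ℝ) p) j = if j = i then a else 0 := by
  rw [lp.single_apply, Pi.single_apply]

/-- Extension by zero along an injection of the index sets. -/
noncomputable def lpExtend [Fact (1 ≤ p)] (hp : p ≠ ∞) (e : ι ↪ κ) :
    lp (fun _ : ι => ℝ) p →+ lp (fun _ : κ => ℝ) p where
  toFun f := ⟨Function.extend e f 0, memℓp_extend_zero hp e (lp.memℓp f)⟩
  map_zero' := by
    ext k
    change Function.extend e (0 : ι → ℝ) (0 : κ → ℝ) k = 0
    rw [Function.extend_zero]
    rfl
  map_add' f g := by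
    ext k
    change Function.extend e ((f : ι → ℝ) + (g : ι → ℝ)) (0 : κ → ℝ) k =
      Function.extend e f (0 : κ → ℝ) k + Function.extend e g (0 : κ → ℝ) k
    by_cases hk : ∃ i, e i = k
    · obtain ⟨i, rfl⟩ := hk
      simp [e.injective.extend_apply]
    · simp [Function.extend_apply' _ _ _ hk]

lemma lpExtend_apply [Fact (1 ≤ p)] (hp : p ≠ ∞) (e : ι ↪ κ) (f : lp (fun _ : ι => ℝ) p) (i : ι) :
    lpExtend hp e f (e i) = f i :=
  e.injective.extend_apply _ _ _

lemma lpExtend_apply_of_notMem [Fact (1 ≤ p)] (hp : p ≠ ∞) (e : ι ↪ κ)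
    (f : lp (fun _ : ι => ℝ) p) {k : κ} (hk : ∀ i, e i ≠ k) : lpExtend hp e f k = 0 :=
  Function.extend_apply' _ _ _ (by simpa using hk)

lemma norm_lpExtend [Fact (1 ≤ p)] (hp : p ≠ ∞) (e : ι ↪ κ) (f : lp (fun _ : ι => ℝ) p) :
    ‖lpExtend hp e f‖ = ‖f‖ := by
  have hq := toReal_pos_of_one_le hp
  rw [lp.norm_eq_tsum_rpow hq, lp.norm_eq_tsum_rpow hq]
  congr 1
  refine (e.injective.tsum_eq fun k hk => ?_).symm.trans (tsum_congr fun i => ?_)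
  · by_contra hk'
    refine hk ?_
    simp only
    rw [lpExtend_apply_of_notMem hp e f (by simpa using hk'), norm_zero, Real.zero_rpow hq.ne']
  · rw [lpExtend_apply]

/-- Restriction along an injection of the index sets. -/
noncomputable def lpComap [Fact (1 ≤ p)] (hp : p ≠ ∞) (e : ι ↪ κ) :
    lp (fun _ : κ => ℝ) p →+ lp (fun _ : ι => ℝ) p where
  toFun f := ⟨fun i => f (e i), memℓp_gen <|
    ((lp.memℓp f).summable (toReal_pos_of_one_le hp)).comp_injective e.injective⟩
  map_zero' := rfl
  map_add' _ _ := rfl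

lemma lpComap_apply [Fact (1 ≤ p)] (hp : p ≠ ∞) (e : ι ↪ κ) (f : lp (fun _ : κ => ℝ) p) (i : ι) :
    lpComap hp e f i = f (e i) := rfl

lemma norm_lpComap_le [Fact (1 ≤ p)] (hp : p ≠ ∞) (e : ι ↪ κ) (f : lp (fun _ : κ => ℝ) p) :
    ‖lpComap hp e f‖ ≤ ‖f‖ := by
  have hq := toReal_pos_of_one_le hp
  rw [lp.norm_eq_tsum_rpow hq, lp.norm_eq_tsum_rpow hq]
  refine Real.rpow_le_rpow (tsum_nonneg fun i => by positivity) ?_ (by positivity)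
  exact tsum_comp_le_tsum_of_inj ((lp.memℓp f).summable hq) (fun i => by positivity) e.injective

lemma lpComap_lpExtend [Fact (1 ≤ p)] (hp : p ≠ ∞) (e : ι ↪ κ) (f : lp (fun _ : ι => ℝ) p) :
    lpComap hp e (lpExtend hp e f) = f := by
  ext i
  rw [lpComap_apply, lpExtend_apply]

lemma lpComap_lpExtend_of_disjoint {ι' : Type w} [Fact (1 ≤ p)] (hp : p ≠ ∞) (e : ι ↪ κ)
    (e' : ι' ↪ κ) (h : ∀ i j, e i ≠ e' j) (f : lp (fun _ : ι' => ℝ) p) :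
    lpComap hp e (lpExtend hp e' f) = 0 := by
  ext i
  rw [lpComap_apply, lpExtend_apply_of_notMem _ _ _ fun j => (h i j).symm]
  simp

/-- Restriction to the image of `e` is a contraction that kills the second summand. This makes a
direct sum inside one sequence space dominate each of its parts. -/
lemma norm_le_norm_lpExtend_add {ι' : Type w} [Fact (1 ≤ p)] (hp : p ≠ ∞) (e : ι ↪ κ)
    (e' : ι' ↪ κ) (h : ∀ i j, e i ≠ e' j) (f : lp (fun _ : ι => ℝ) p)
    (g : lp (fun _ : ι' => ℝ) p) : ‖f‖ ≤ ‖lpExtend hp e f + lpExtend hp e' g‖ := by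
  refine le_trans ?_ (norm_lpComap_le hp e _)
  rw [map_add, lpComap_lpExtend, lpComap_lpExtend_of_disjoint hp e e' h, add_zero]

end Reindex

/-! ### Weights -/

/-- Discrete form of integrating `x ^ t`; the induction step is Bernoulli's inequality at `-1 / (n +
1)`. -/
lemma rpow_le_mul_sum_rpow {t : ℝ} (ht : 0 ≤ t) (n : ℕ) :
    (n : ℝ) ^ (t + 1) ≤ (t + 1) * ∑ i ∈ Finset.range n, ((i : ℝ) + 1) ^ t := by
  induction n with
  | zero => simp [Real.zero_rpow (by positivity : t + 1 ≠ 0)]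
  | succ n ih =>
    rw [Finset.sum_range_succ, mul_add]
    have hn : (0 : ℝ) < n + 1 := by positivity
    have h1 := one_add_mul_self_le_rpow_one_add (s := -1 / ((n : ℝ) + 1)) (p := t + 1)
      (by rw [le_div_iff₀ hn]; linarith [(Nat.cast_nonneg n : (0 : ℝ) ≤ n)]) (by linarith)
    have h2 : 1 + -1 / ((n : ℝ) + 1) = n / (n + 1) := by field_simp; ring
    rw [h2, Real.div_rpow (Nat.cast_nonneg n) hn.le, le_div_iff₀ (by positivity)] at h1
    have h3 : (1 + (t + 1) * (-1 / ((n : ℝ) + 1))) * ((n : ℝ) + 1) ^ (t + 1)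
        = ((n : ℝ) + 1) ^ (t + 1) - (t + 1) * ((n : ℝ) + 1) ^ t := by
      rw [Real.rpow_add_one hn.ne']
      field_simp
      ring
    push_cast
    linarith

lemma rpow_add_two_sub_le {s : ℝ} (hs : 0 ≤ s) (hs1 : s ≤ 1) (i : ℕ) :
    ((i : ℝ) + 1 + 1) ^ s - ((i : ℝ) + 1) ^ s ≤ s * ((i : ℝ) + 1) ^ (s - 1) := by
  have hi : (0 : ℝ) < i + 1 := by positivity
  have h1 := rpow_one_add_le_one_add_mul_self (s := 1 / ((i : ℝ) + 1)) (p := s)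
    (le_trans (by norm_num) (by positivity : (0 : ℝ) ≤ 1 / ((i : ℝ) + 1))) hs hs1
  have h2 : 1 + 1 / ((i : ℝ) + 1) = (i + 1 + 1) / (i + 1) := by field_simp
  rw [h2, Real.div_rpow (by positivity) hi.le, div_le_iff₀ (by positivity)] at h1
  have h3 : (1 + s * (1 / ((i : ℝ) + 1))) * ((i : ℝ) + 1) ^ s
      = ((i : ℝ) + 1) ^ s + s * ((i : ℝ) + 1) ^ (s - 1) := by
    rw [Real.rpow_sub_one hi.ne']
    ring
  linarith

/-- Weights for which the weighted path embedding of a rooted tree into `ℓ^q` is Lipschitz and has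
compression at least `γ`. -/
lemma exists_tree_weights {q γ : ℝ} (hq : 1 ≤ q) (hγ : 0 < γ) (hγ1 : γ < 1) :
    ∃ (w : ℕ → ℝ) (B c : ℝ), 0 < c ∧ 0 ≤ B ∧
      (∀ n, |w 0| ^ q + ∑ i ∈ Finset.range n, |w (i + 1) - w i| ^ q ≤ B ^ q) ∧
      ∀ n : ℕ, (c * (n : ℝ) ^ γ) ^ q ≤ ∑ i ∈ Finset.range n, |w i| ^ q := by
  have hq0 : 0 < q := zero_lt_one.trans_le hq
  -- With weights `(i + 1) ^ s` the sum of `q`-th powers grows like `n ^ (s * q + 1)`, and `s ≥ γ -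
  -- 1 / q` makes this at least of order `n ^ (γ * q)`. If `γ ≤ 1 / q`, constant weights suffice.
  set s := max (γ - 1 / q) 0 with hs
  have hs0 : 0 ≤ s := le_max_right _ _
  have hs1 : s ≤ 1 := max_le (by have : 0 ≤ 1 / q := by positivity
                                 linarith) zero_le_one
  have hsum : Summable fun i : ℕ => |((i : ℝ) + 1 + 1) ^ s - ((i : ℝ) + 1) ^ s| ^ q := by
    rcases hs0.eq_or_lt with h0 | h0
    · simp [← h0, Real.zero_rpow hq0.ne', summable_zero]
    · have hsγ : s = γ - 1 / q := by
        rcases max_choice (γ - 1 / q) 0 with h | h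
        · exact h
        · exact absurd (hs.trans h) h0.ne'
      -- The strict inequality `γ < 1` is indispensable here: for `γ = 1` the exponent would be `-1`
      -- and the bounding series would diverge.
      have hexp : (s - 1) * q < -1 := by
        have : (s - 1) * q = (γ - 1) * q - 1 := by rw [hsγ]; field_simp; ring
        rw [this]
        nlinarith
      have h1 : Summable fun i : ℕ => s ^ q * (((i + 1 : ℕ) : ℝ) ^ ((s - 1) * q)) :=
        ((summable_nat_add_iff 1).2 (Real.summable_nat_rpow.2 hexp)).mul_left _
      refine Summable.of_nonneg_of_le (fun i => by positivity) (fun i => ?_) h1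
      have hi : (0 : ℝ) < i + 1 := by positivity
      have h2 : 0 ≤ ((i : ℝ) + 1 + 1) ^ s - ((i : ℝ) + 1) ^ s :=
        sub_nonneg.2 (Real.rpow_le_rpow hi.le (by linarith) hs0)
      rw [abs_of_nonneg h2]
      calc _ ≤ (s * ((i : ℝ) + 1) ^ (s - 1)) ^ q :=
            Real.rpow_le_rpow h2 (rpow_add_two_sub_le hs0 hs1 i) hq0.le
        _ = _ := by
            rw [Real.mul_rpow hs0 (by positivity), ← Real.rpow_mul hi.le]
            push_cast
            rfl
  have ht : 0 ≤ s * q := by positivity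
  refine ⟨fun i => ((i : ℝ) + 1) ^ s,
    (1 + ∑' i : ℕ, |((i : ℝ) + 1 + 1) ^ s - ((i : ℝ) + 1) ^ s| ^ q) ^ q⁻¹,
    ((s * q + 1)⁻¹) ^ q⁻¹, by positivity, ?_, fun n => ?_, fun n => ?_⟩
  · have : 0 ≤ ∑' i : ℕ, |((i : ℝ) + 1 + 1) ^ s - ((i : ℝ) + 1) ^ s| ^ q :=
      tsum_nonneg fun i => by positivity
    positivity
  · have : 0 ≤ ∑' i : ℕ, |((i : ℝ) + 1 + 1) ^ s - ((i : ℝ) + 1) ^ s| ^ q :=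
      tsum_nonneg fun i => by positivity
    rw [Real.rpow_inv_rpow (by positivity) hq0.ne']
    have h1 := hsum.sum_le_tsum (Finset.range n) fun i _ => by positivity
    simp only [Nat.cast_zero, zero_add, Real.one_rpow, abs_one, Nat.cast_add, Nat.cast_one]
    linarith
  · rw [Real.mul_rpow (by positivity) (by positivity), Real.rpow_inv_rpow (by positivity) hq0.ne',
      inv_mul_le_iff₀ (by positivity), ← Real.rpow_mul (Nat.cast_nonneg n)]
    have h1 : (n : ℝ) ^ (γ * q) ≤ (n : ℝ) ^ (s * q + 1) := by
      rcases Nat.eq_zero_or_pos n with rfl | hn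
      · simp [Real.zero_rpow (by positivity : γ * q ≠ 0),
          Real.zero_rpow (by positivity : s * q + 1 ≠ 0)]
      · refine Real.rpow_le_rpow_of_exponent_le (by exact_mod_cast hn) ?_
        have h2 : γ - 1 / q ≤ s := le_max_left _ _
        have h3 := mul_le_mul_of_nonneg_right h2 hq0.le
        have h4 : (γ - 1 / q) * q = γ * q - 1 := by field_simp
        linarith
    refine h1.trans ((rpow_le_mul_sum_rpow ht n).trans_eq ?_)
    congr 1
    refine Finset.sum_congr rfl fun i _ => ?_
    rw [abs_of_nonneg (by positivity), ← Real.rpow_mul (by positivity)]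

/-! ### Paths in a rooted tree -/

section Tree

open scoped Classical in
/-- The weighted sum of the entries of a list, the weight depending on the position. -/
noncomputable def treeVec {B : Type u} (p : ℝ≥0∞) (w : ℕ → ℝ) (l : List B) :
    lp (fun _ : B => ℝ) p :=
  ∑ b ∈ l.toFinset, lp.single p b (w (l.idxOf b))

variable {B : Type u} {p : ℝ≥0∞} {w : ℕ → ℝ}

open scoped Classical in
lemma List.Nodup.sum_toFinset_idxOf {l : List B} (hl : l.Nodup) (g : ℕ → ℝ) :
    ∑ b ∈ l.toFinset, g (l.idxOf b) = ∑ i ∈ Finset.range l.length, g i := by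
  refine Finset.sum_nbij (fun b => l.idxOf b) (fun b hb => ?_) (fun b hb c hc h => ?_)
    (fun i hi => ?_) fun _ _ => rfl
  · simpa [List.idxOf_lt_length_iff] using hb
  · simp only [Finset.mem_coe, List.mem_toFinset] at hb hc
    exact (List.idxOf_inj hb).1 h
  · simp only [Finset.coe_range, Set.mem_Iio] at hi
    exact ⟨l[i], by simp, hl.idxOf_getElem i hi⟩

open scoped Classical in
lemma treeVec_apply (l : List B) (b : B) :
    treeVec p w l b = if b ∈ l then w (l.idxOf b) else 0 := by
  rw [treeVec, lp_sum_apply]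
  simp

/-- A new vertex at the tip shifts every position by one, so the difference has entry `w 0` at the
new vertex and increments of `w` along the old path. -/
lemma norm_treeVec_cons_sub_le [Fact (1 ≤ p)] (hp : p ≠ ∞) {C : ℝ} (hC : 0 ≤ C)
    (h : ∀ n, |w 0| ^ p.toReal +
      ∑ i ∈ Finset.range n, |w (i + 1) - w i| ^ p.toReal ≤ C ^ p.toReal)
    {b : B} {l : List B} (hl : (b :: l).Nodup) :
    ‖treeVec p w (b :: l) - treeVec p w l‖ ≤ C := by
  classical
  have hq := toReal_pos_of_one_le hp
  obtain ⟨hb, hl⟩ := List.nodup_cons.1 hl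
  have key : treeVec p w (b :: l) - treeVec p w l = ∑ c ∈ (b :: l).toFinset,
      lp.single p c (if c = b then w 0 else w (l.idxOf c + 1) - w (l.idxOf c)) := by
    ext c
    rw [lp_sub_apply, treeVec_apply, treeVec_apply, lp_sum_apply]
    simp only [lp_single_apply, List.toFinset_cons]
    by_cases hc : c = b
    · subst hc
      simp [hb]
    · by_cases hcl : c ∈ l <;> simp [hc, hcl, List.idxOf_cons_ne _ (Ne.symm hc)]
  rw [← Real.rpow_le_rpow_iff (norm_nonneg _) hC hq, key,
    lp.norm_sum_single hq (E := fun _ : B => ℝ)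
      (fun c => if c = b then w 0 else w (l.idxOf c + 1) - w (l.idxOf c)),
    List.toFinset_cons, Finset.sum_insert (by simpa using hb)]
  refine le_trans (le_of_eq ?_) (h l.length)
  rw [← hl.sum_toFinset_idxOf fun i => |w (i + 1) - w i| ^ p.toReal]
  simp only [if_true, Real.norm_eq_abs]
  congr 1
  refine Finset.sum_congr rfl fun c hc => ?_
  rw [if_neg]
  rintro rfl
  exact hb (by simpa using hc)

/-- On the coordinates in `l₁` the second vector vanishes, and the weights there are `w 0, w 1, ...`
because positions are counted from the tip. -/
lemma le_norm_treeVec_sub [Fact (1 ≤ p)] (hp : p ≠ ∞) {d : ℝ} (hd : 0 ≤ d) {l₁ l₂ l' : List B}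
    (h : d ^ p.toReal ≤ ∑ i ∈ Finset.range l₁.length, |w i| ^ p.toReal)
    (hl : l₁.Nodup) (hdisj : ∀ b ∈ l₁, b ∉ l') :
    d ≤ ‖treeVec p w (l₁ ++ l₂) - treeVec p w l'‖ := by
  classical
  have hq := toReal_pos_of_one_le hp
  rw [← Real.rpow_le_rpow_iff hd (norm_nonneg _) hq]
  refine h.trans (le_trans (le_of_eq ?_) (lp.sum_rpow_le_norm_rpow hq _ l₁.toFinset))
  rw [← hl.sum_toFinset_idxOf fun i => |w i| ^ p.toReal]
  refine Finset.sum_congr rfl fun c hc => ?_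
  have hc : c ∈ l₁ := by simpa using hc
  rw [lp_sub_apply, treeVec_apply, treeVec_apply, if_neg (hdisj c hc),
    if_pos (List.mem_append_left _ hc), List.idxOf_append_of_mem hc, sub_zero, Real.norm_eq_abs]

end Tree

/-! ### Lists as vertices of a tree of spaces -/

/-- An elementary change at the beginning of a list: the first entry is replaced by an entry related
by `R`, or an entry satisfying `Q` is added or removed. -/
inductive ListMove {A : Type u} (R : A → A → Prop) (Q : A → Prop) : List A → List A → Prop
  | refl (l : List A) : ListMove R Q l l
  | replace (t : List A) {a b : A} (h : R a b) : ListMove R Q (a :: t) (b :: t)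
  | push (t : List A) {a : A} (h : Q a) : ListMove R Q t (a :: t)
  | pop (t : List A) {a : A} (h : Q a) : ListMove R Q (a :: t) t

lemma List.exists_common_prefix {A : Type u} (l l' : List A) :
    (∃ r a b s t, l = r ++ a :: s ∧ l' = r ++ b :: t ∧ a ≠ b) ∨
      (∃ s, l = l' ++ s) ∨ ∃ s, l' = l ++ s := by
  induction l generalizing l' with
  | nil => exact .inr (.inr ⟨l', rfl⟩)
  | cons a l ih =>
    cases l' with
    | nil => exact .inr (.inl ⟨_, rfl⟩)
    | cons b l' =>
      by_cases hab : a = b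
      · subst hab
        rcases ih l' with ⟨r, x, y, s, t, rfl, rfl, h⟩ | ⟨s, rfl⟩ | ⟨s, rfl⟩
        · exact .inl ⟨a :: r, x, y, s, t, rfl, rfl, h⟩
        · exact .inr (.inl ⟨s, rfl⟩)
        · exact .inr (.inr ⟨s, rfl⟩)
      · exact .inl ⟨[], a, b, l, l', rfl, rfl, hab⟩

lemma List.exists_common_suffix {A : Type u} (l l' : List A) :
    (∃ r a b s t, l = s ++ a :: r ∧ l' = t ++ b :: r ∧ a ≠ b) ∨
      (∃ s, l = s ++ l') ∨ ∃ s, l' = s ++ l := by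
  rcases List.exists_common_prefix l.reverse l'.reverse with
    ⟨r, a, b, s, t, h, h', hab⟩ | ⟨s, h⟩ | ⟨s, h⟩
  · refine .inl ⟨r.reverse, a, b, s.reverse, t.reverse, ?_, ?_, hab⟩
    · simpa using congrArg List.reverse h
    · simpa using congrArg List.reverse h'
  · exact .inr (.inl ⟨s.reverse, by simpa using congrArg List.reverse h⟩)
  · exact .inr (.inr ⟨s.reverse, by simpa using congrArg List.reverse h⟩)

/-! ### Paths in the tree attached to lists -/

section Tokens

variable {A : Type u}

/-- The path of length `n` starting at the vertex `t`. -/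
def rayTokens (t : List A) (n : ℕ) : List (List A × ℕ) :=
  ((List.range n).map fun k => (t, k)).reverse

/-- The path from `r` to `u ++ r` in the tree in which every `t : List A` is the origin of a ray, and
`a :: t` is attached to this ray at distance `ℓ a` from `t`. -/
def pathTokens (ℓ : A → ℕ) : List A → List A → List (List A × ℕ)
  | [], _ => []
  | a :: u, r => rayTokens (u ++ r) (ℓ a) ++ pathTokens ℓ u r

variable {ℓ : A → ℕ}

lemma rayTokens_succ (t : List A) (n : ℕ) : rayTokens t (n + 1) = (t, n) :: rayTokens t n := by
  simp [rayTokens, List.range_succ]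

lemma length_rayTokens (t : List A) (n : ℕ) : (rayTokens t n).length = n := by
  simp [rayTokens]

lemma nodup_rayTokens (t : List A) (n : ℕ) : (rayTokens t n).Nodup := by
  rw [rayTokens, List.nodup_reverse]
  exact List.nodup_range.map fun a b h => (Prod.ext_iff.1 h).2

lemma fst_eq_of_mem_rayTokens {t : List A} {n : ℕ} {x : List A × ℕ} (hx : x ∈ rayTokens t n) :
    x.1 = t := by
  simp only [rayTokens, List.mem_reverse, List.mem_map] at hx
  obtain ⟨k, -, rfl⟩ := hx
  rfl

lemma pathTokens_append (u v r : List A) :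
    pathTokens ℓ (u ++ v) r = pathTokens ℓ u (v ++ r) ++ pathTokens ℓ v r := by
  induction u with
  | nil => rfl
  | cons a u ih => simp [pathTokens, ih]

lemma length_pathTokens (u r : List A) : (pathTokens ℓ u r).length = (u.map ℓ).sum := by
  induction u with
  | nil => rfl
  | cons a u ih => simp [pathTokens, ih, length_rayTokens]

/-- The first component of a token is the list from which its ray issues. The strict inequality of
lengths keeps the ray issuing from `u ++ r` itself off the path, which gives distinctness of tokens
and disjointness of branches. -/
lemma suffix_of_mem_pathTokens {u r : List A} {x : List A × ℕ} (hx : x ∈ pathTokens ℓ u r) :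
    r <:+ x.1 ∧ x.1 <:+ u ++ r ∧ x.1.length < u.length + r.length := by
  induction u with
  | nil => simp [pathTokens] at hx
  | cons a u ih =>
    rw [pathTokens, List.mem_append] at hx
    rcases hx with hx | hx
    · rw [fst_eq_of_mem_rayTokens hx]
      exact ⟨List.suffix_append _ _, List.suffix_cons _ _, by simp⟩
    · obtain ⟨h1, h2, h3⟩ := ih hx
      exact ⟨h1, h2.trans (List.suffix_cons _ _), by simp; omega⟩

lemma nodup_rayTokens_append (u r : List A) (n : ℕ) (h : (pathTokens ℓ u r).Nodup) :
    (rayTokens (u ++ r) n ++ pathTokens ℓ u r).Nodup := by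
  refine (nodup_rayTokens _ _).append h fun x hx hx' => ?_
  have h1 := (suffix_of_mem_pathTokens hx').2.2
  rw [fst_eq_of_mem_rayTokens hx, List.length_append] at h1
  exact lt_irrefl _ h1

lemma nodup_pathTokens (u r : List A) : (pathTokens ℓ u r).Nodup := by
  induction u with
  | nil => exact List.nodup_nil
  | cons a u ih => exact nodup_rayTokens_append u r _ ih

end Tokens

/-! ### The block and path embeddings of lists -/

section Embedding

variable {A : Type u} {ι : Type v} {p : ℝ≥0∞} [Fact (1 ≤ p)] (hp : p ≠ ∞)

/-- The inclusion of the block of coordinates belonging to `t`. -/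
def blockEmbedding (ι : Type v) (t : List A) : ι ↪ List A × ι :=
  ⟨fun i => (t, i), fun _ _ h => (Prod.ext_iff.1 h).2⟩

/-- The sum of the vectors `φ a` over the entries `a` of a list, with `φ a` placed into the block of
coordinates belonging to the part of the list after `a`. -/
noncomputable def blockVec (φ : A → lp (fun _ : ι => ℝ) p) :
    List A → lp (fun _ : List A × ι => ℝ) p
  | [] => 0
  | a :: t => lpExtend hp (blockEmbedding ι t) (φ a) + blockVec φ t

variable {φ : A → lp (fun _ : ι => ℝ) p}

lemma lpComap_blockVec_of_length_le {r t : List A} (h : t.length ≤ r.length) :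
    lpComap hp (blockEmbedding ι r) (blockVec hp φ t) = 0 := by
  induction t with
  | nil => exact map_zero _
  | cons a t ih =>
    have h' : t.length < r.length := h
    rw [blockVec, map_add, ih h'.le, add_zero]
    refine lpComap_lpExtend_of_disjoint hp _ _ (fun i j hij => ?_) _
    have : r = t := (Prod.ext_iff.1 hij).1
    rw [this] at h'
    exact lt_irrefl _ h'

/-- The block of an entry is indexed by what follows it, so only the entry directly in front of `r`
contributes to block `r`; all other entries are followed by lists of different length. -/
lemma lpComap_blockVec (u : List A) (a : A) (r : List A) :
    lpComap hp (blockEmbedding ι r) (blockVec hp φ (u ++ a :: r)) = φ a := by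
  induction u with
  | nil =>
    rw [List.nil_append, blockVec, map_add, lpComap_lpExtend,
      lpComap_blockVec_of_length_le hp le_rfl, add_zero]
  | cons b u ih =>
    rw [List.cons_append, blockVec, map_add, ih,
      lpComap_lpExtend_of_disjoint hp _ _ (fun i j hij => ?_), zero_add]
    have h : r = u ++ a :: r := (Prod.ext_iff.1 hij).1
    have := congrArg List.length h
    simp at this
    omega

lemma norm_sub_le_norm_blockVec_sub (u v : List A) (a b : A) (r : List A) :
    ‖φ a - φ b‖ ≤ ‖blockVec hp φ (u ++ a :: r) - blockVec hp φ (v ++ b :: r)‖ := by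
  refine le_trans (le_of_eq ?_) (norm_lpComap_le hp (blockEmbedding ι r) _)
  rw [map_sub, lpComap_blockVec, lpComap_blockVec]

/-- A move leaves the tail alone, hence changes the vector in a single block. -/
lemma ListMove.norm_blockVec_sub_le {R : A → A → Prop} {Q : A → Prop} {K : ℝ} (hK : 0 ≤ K)
    (hR : ∀ a b, R a b → ‖φ a - φ b‖ ≤ K) (hQ : ∀ a, Q a → ‖φ a‖ ≤ K) {l l' : List A}
    (h : ListMove R Q l l') : ‖blockVec hp φ l - blockVec hp φ l'‖ ≤ K := by
  cases h with
  | refl => simpa using hK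
  | replace t h =>
    rw [blockVec, blockVec, add_sub_add_right_eq_sub, ← map_sub, norm_lpExtend]
    exact hR _ _ h
  | push t h =>
    rw [norm_sub_rev, blockVec, add_sub_cancel_right, norm_lpExtend]
    exact hQ _ h
  | pop t h =>
    rw [blockVec, add_sub_cancel_right, norm_lpExtend]
    exact hQ _ h

variable {w : ℕ → ℝ} {C : ℝ} {ℓ : A → ℕ}

include hp in
-- Telescoping: lengthening the last ray by one vertex costs at most `C`.
lemma norm_treeVec_rayTokens_sub_le (hC : 0 ≤ C)
    (hw : ∀ n, |w 0| ^ p.toReal +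
      ∑ i ∈ Finset.range n, |w (i + 1) - w i| ^ p.toReal ≤ C ^ p.toReal)
    (t : List A) {s : List (List A × ℕ)} (hs : ∀ n, (rayTokens t n ++ s).Nodup) (n m : ℕ) :
    ‖treeVec p w (rayTokens t n ++ s) - treeVec p w (rayTokens t m ++ s)‖ ≤
      C * |(n : ℝ) - m| := by
  wlog hmn : m ≤ n generalizing n m
  · rw [norm_sub_rev, abs_sub_comm]
    exact this m n (le_of_not_ge hmn)
  obtain ⟨k, rfl⟩ := Nat.exists_eq_add_of_le hmn
  clear hmn
  induction k with
  | zero => simp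
  | succ k ih =>
    have h1 := hs (m + k + 1)
    rw [rayTokens_succ, List.cons_append] at h1
    have h2 := norm_treeVec_cons_sub_le hp hC hw h1
    have h3 := norm_sub_le_norm_sub_add_norm_sub
      (treeVec p w (rayTokens t (m + (k + 1)) ++ s)) (treeVec p w (rayTokens t (m + k) ++ s))
      (treeVec p w (rayTokens t m ++ s))
    rw [← add_assoc, rayTokens_succ, List.cons_append] at h3 ⊢
    push_cast at ih ⊢
    rw [abs_of_nonneg (by linarith [(Nat.cast_nonneg k : (0 : ℝ) ≤ k)])] at ih ⊢
    linarith

include hp in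
lemma ListMove.norm_treeVec_sub_le (hC : 0 ≤ C)
    (hw : ∀ n, |w 0| ^ p.toReal +
      ∑ i ∈ Finset.range n, |w (i + 1) - w i| ^ p.toReal ≤ C ^ p.toReal)
    {R : A → A → Prop} {Q : A → Prop} {K : ℝ} (hK : 0 ≤ K)
    (hR : ∀ a b, R a b → |(ℓ a : ℝ) - ℓ b| ≤ K) (hQ : ∀ a, Q a → (ℓ a : ℝ) ≤ K) {l l' : List A}
    (h : ListMove R Q l l') :
    ‖treeVec p w (pathTokens ℓ l []) - treeVec p w (pathTokens ℓ l' [])‖ ≤ C * K := by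
  -- Every move changes the length of the ray at the tip; pushing or popping an entry is the case
  -- where one of the two lengths is `0`.
  have key : ∀ (t : List A) (n m : ℕ), |(n : ℝ) - m| ≤ K →
      ‖treeVec p w (rayTokens (t ++ []) n ++ pathTokens ℓ t []) -
        treeVec p w (rayTokens (t ++ []) m ++ pathTokens ℓ t [])‖ ≤ C * K := fun t n m h =>
    (norm_treeVec_rayTokens_sub_le hp hC hw _
      (fun n => nodup_rayTokens_append t [] n (nodup_pathTokens t [])) n m).trans
      (mul_le_mul_of_nonneg_left h hC)
  cases h with
  | refl => simpa using mul_nonneg hC hK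
  | replace t h => exact key t _ _ (hR _ _ h)
  | @push t a h => exact key _ 0 (ℓ a) (by simpa using hQ _ h)
  | @pop t a h => exact key _ (ℓ a) 0 (by simpa using hQ _ h)

include hp in
-- The path from `r` to `u ++ r` avoids the path to `l`: the origin of a common token would have `r`
-- as a suffix and be a proper suffix of `l`, which `h` forbids. The case `r = l` is allowed since
-- the path to `l` has no token with origin `l`.
lemma mul_rpow_le_norm_treeVec_sub {c γ : ℝ} (hc : 0 ≤ c)
    (hw : ∀ n : ℕ, (c * (n : ℝ) ^ γ) ^ p.toReal ≤ ∑ i ∈ Finset.range n, |w i| ^ p.toReal)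
    (u r l : List A) (h : r <:+ l → r = l) :
    c * ((u.map ℓ).sum : ℝ) ^ γ ≤
      ‖treeVec p w (pathTokens ℓ (u ++ r) []) - treeVec p w (pathTokens ℓ l [])‖ := by
  rw [pathTokens_append]
  refine le_norm_treeVec_sub hp (by positivity) ?_ (nodup_pathTokens _ _) fun x hx hx' => ?_
  · rw [length_pathTokens]
    exact_mod_cast hw (u.map ℓ).sum
  · obtain ⟨h1, -, -⟩ := suffix_of_mem_pathTokens hx
    obtain ⟨-, h2, h3⟩ := suffix_of_mem_pathTokens hx'
    simp only [List.append_nil, List.length_nil, add_zero] at h1 h2 h3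
    have h4 := h (h1.trans h2)
    have := h1.length_le
    rw [h4] at this
    omega

end Embedding

/-! ### Compression and distortion from normal forms -/

section NormalForm

variable {Γ : Type u} [Group Γ] {S : Set Γ} {A : Type v} {ι : Type w}

lemma wordNorm_prod_map_le (hS : Subgroup.closure S = ⊤) {val : A → Γ} {ℓ : A → ℕ} {K : ℝ}
    (h : ∀ a, wordNorm S (val a) ≤ K * ℓ a) (l : List A) :
    wordNorm S (l.map val).prod ≤ K * ((l.map ℓ).sum : ℕ) := by
  induction l with
  | nil => simp [wordNorm_one]
  | cons a l ih =>
    rw [List.map_cons, List.prod_cons, List.map_cons, List.sum_cons, Nat.cast_add, mul_add]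
    exact (wordNorm_mul_le hS _ _).trans (add_le_add (h a) ih)

/-- A group whose elements have normal forms such that left multiplication by a generator only
changes the beginning of the normal form has compression `γ < 1` if the set of letters has. -/
theorem hasCompression_of_normalForm (hS : Subgroup.closure S = ⊤) [Countable A] [Countable ι]
    {p : ℝ≥0∞} [Fact (1 ≤ p)] (hp : p ≠ ∞) {γ K : ℝ} (hγ : 0 < γ) (hγ1 : γ < 1) (hK : 1 ≤ K)
    (L : Γ → List A) (val : A → Γ) (ℓ : A → ℕ) (φ : A → lp (fun _ : ι => ℝ) p) (dA : A → A → ℝ)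
    (R : A → A → Prop) (Q : A → Prop)
    (hL : ∀ x, ∀ s ∈ S, ∃ m, ListMove R Q (L x) m ∧ ListMove R Q m (L (s * x)))
    (hR : ∀ a b, R a b → ‖φ a - φ b‖ ≤ K ∧ |(ℓ a : ℝ) - ℓ b| ≤ K)
    (hQ : ∀ a, Q a → ‖φ a‖ ≤ K ∧ (ℓ a : ℝ) ≤ K)
    (hval : ∀ x, wordNorm S (x * ((L x).map val).prod⁻¹) ≤ K)
    (hℓ : ∀ a, wordNorm S (val a) ≤ K * ℓ a)
    (hd0 : ∀ a b, 0 ≤ dA a b)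
    (hd : ∀ a b, wordNorm S (val a * (val b)⁻¹) ≤ K * dA a b + K)
    (hφ : ∀ a b, dA a b ^ γ ≤ K * ‖φ a - φ b‖ + K) :
    HasCompression (wordDist S) (lp (fun _ : ℕ => ℝ) p) γ := by
  have hK0 : 0 ≤ K := zero_le_one.trans hK
  have hp1 : 1 ≤ p.toReal := by
    have := ENNReal.toReal_mono hp (Fact.out : 1 ≤ p)
    simpa using this
  obtain ⟨w, C, c, hc, hC, hw1, hw2⟩ := exists_tree_weights hp1 hγ hγ1
  obtain ⟨e⟩ := nonempty_embedding_nat ((List A × ι) ⊕ (List A × ℕ))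
  let e₁ : List A × ι ↪ ℕ := Function.Embedding.inl.trans e
  let e₂ : List A × ℕ ↪ ℕ := Function.Embedding.inr.trans e
  have he : ∀ i j, e₁ i ≠ e₂ j := fun i j h => Sum.inl_ne_inr (e.injective h)
  let Φ : List A → lp (fun _ : ℕ => ℝ) p := fun l =>
    lpExtend hp e₁ (blockVec hp φ l) + lpExtend hp e₂ (treeVec p w (pathTokens ℓ l []))
  have hΦ : ∀ l l', Φ l - Φ l' = lpExtend hp e₁ (blockVec hp φ l - blockVec hp φ l') +
      lpExtend hp e₂ (treeVec p w (pathTokens ℓ l []) - treeVec p w (pathTokens ℓ l' [])) := by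
    intro l l'
    rw [map_sub, map_sub]
    exact add_sub_add_comm _ _ _ _
  have hblock : ∀ l l', ‖blockVec hp φ l - blockVec hp φ l'‖ ≤ ‖Φ l - Φ l'‖ := by
    intro l l'
    rw [hΦ]
    exact norm_le_norm_lpExtend_add hp e₁ e₂ he _ _
  have htree : ∀ l l', ‖treeVec p w (pathTokens ℓ l []) - treeVec p w (pathTokens ℓ l' [])‖ ≤
      ‖Φ l - Φ l'‖ := by
    intro l l'
    rw [hΦ, add_comm]
    exact norm_le_norm_lpExtend_add hp e₂ e₁ (fun i j => (he j i).symm) _ _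
  have hmove : ∀ l l', ListMove R Q l l' → ‖Φ l - Φ l'‖ ≤ K + C * K := by
    intro l l' h
    rw [hΦ]
    refine (norm_add_le _ _).trans ?_
    rw [norm_lpExtend, norm_lpExtend]
    exact add_le_add
      (h.norm_blockVec_sub_le hp hK0 (fun a b h => (hR a b h).1) fun a h => (hQ a h).1)
      (h.norm_treeVec_sub_le hp hC hw1 hK0 (fun a b h => (hR a b h).2) fun a h => (hQ a h).2)
  -- Passing to inverses turns the right multiplication along an edge into a left multiplication, to
  -- which `hL` applies; its two moves cause the factor `2`.
  have hupper : ∀ g h, dist (Φ (L g⁻¹)) (Φ (L h⁻¹)) ≤ 2 * (K + C * K) * wordDist S g h := by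
    refine le_mul_wordDist hS _ (fun g => (dist_self _).le) (fun g h => dist_comm _ _)
      (fun a b c => dist_triangle _ _ _) fun g s hs => ?_
    obtain ⟨m, h1, h2⟩ := hL (s⁻¹ * g⁻¹) s hs
    rw [mul_inv_cancel_left] at h2
    rw [mul_inv_rev, dist_comm]
    refine (dist_triangle _ (Φ m) _).trans ?_
    rw [dist_eq_norm, dist_eq_norm]
    linarith [hmove _ _ h1, hmove _ _ h2]
  -- `M` is the largest of the at most three pieces of the route between the lists, which explains
  -- the factor `3`; only one piece has to be seen by `Φ`.
  have hlow : ∀ l l' : List A, ∃ M : ℝ, 0 ≤ M ∧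
      wordNorm S ((l.map val).prod * (l'.map val).prod⁻¹) ≤ 3 * K * M + K ∧
      M ^ γ ≤ (K + c⁻¹) * ‖Φ l - Φ l'‖ + K := by
    have htree' : ∀ u r l, (r <:+ l → r = l) →
        ((u.map ℓ).sum : ℝ) ^ γ ≤ (K + c⁻¹) * ‖Φ (u ++ r) - Φ l‖ + K := by
      intro u r l h
      have h1 := (mul_rpow_le_norm_treeVec_sub hp (ℓ := ℓ) hc.le hw2 u r l h).trans (htree _ _)
      rw [← le_inv_mul_iff₀ hc] at h1
      nlinarith [norm_nonneg (Φ (u ++ r) - Φ l)]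
    have happ : ∀ u l : List A,
        wordNorm S (((u ++ l).map val).prod * (l.map val).prod⁻¹) ≤
          3 * K * ((u.map ℓ).sum : ℕ) + K := by
      intro u l
      rw [List.map_append, List.prod_append, mul_inv_cancel_right]
      have := wordNorm_prod_map_le hS hℓ u
      have : 0 ≤ K * ((u.map ℓ).sum : ℕ) := by positivity
      linarith
    intro l l'
    rcases List.exists_common_suffix l l' with ⟨r, a, b, u, v, rfl, rfl, hab⟩ | ⟨u, rfl⟩ | ⟨u, rfl⟩
    · have hsuf : ∀ {a b : A} {v : List A}, a ≠ b →
          (a :: r <:+ v ++ b :: r → a :: r = v ++ b :: r) := by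
        intro a b v hab h
        refine absurd ?_ hab
        have := List.suffix_of_suffix_length_le h (List.suffix_append v (b :: r)) (by simp)
        simpa using this.eq_of_length (by simp)
      have h1 := htree' u (a :: r) (v ++ b :: r) (hsuf hab)
      have h2 := htree' v (b :: r) (u ++ a :: r) (hsuf hab.symm)
      rw [norm_sub_rev] at h2
      have h3 : dA a b ^ γ ≤ (K + c⁻¹) * ‖Φ (u ++ a :: r) - Φ (v ++ b :: r)‖ + K := by
        have h4 := (norm_sub_le_norm_blockVec_sub hp (φ := φ) u v a b r).trans (hblock _ _)
        have h5 : 0 ≤ c⁻¹ * ‖Φ (u ++ a :: r) - Φ (v ++ b :: r)‖ := by positivity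
        nlinarith [hφ a b]
      refine ⟨max (dA a b) (max ((u.map ℓ).sum : ℕ) ((v.map ℓ).sum : ℕ)),
        le_max_of_le_left (hd0 a b), ?_, ?_⟩
      · have h4 : ((u ++ a :: r).map val).prod * ((v ++ b :: r).map val).prod⁻¹ =
            (u.map val).prod * (val a * (val b)⁻¹) * (v.map val).prod⁻¹ := by
          simp only [List.map_append, List.prod_append, List.map_cons, List.prod_cons, mul_inv_rev]
          group
        rw [h4]
        refine (wordNorm_mul_le hS _ _).trans ?_
        rw [wordNorm_inv hS]
        have h5 := wordNorm_mul_le hS (u.map val).prod (val a * (val b)⁻¹)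
        have h6 := wordNorm_prod_map_le hS hℓ u
        have h7 := wordNorm_prod_map_le hS hℓ v
        have h8 := hd a b
        have h9 := mul_le_mul_of_nonneg_left
          (le_max_left (dA a b) (max ((u.map ℓ).sum : ℕ) ((v.map ℓ).sum : ℕ))) hK0
        have h10 := mul_le_mul_of_nonneg_left ((le_max_left _ _).trans
          (le_max_right (dA a b) (max ((u.map ℓ).sum : ℕ) ((v.map ℓ).sum : ℕ)))) hK0
        have h11 := mul_le_mul_of_nonneg_left ((le_max_right _ _).trans
          (le_max_right (dA a b) (max ((u.map ℓ).sum : ℕ) ((v.map ℓ).sum : ℕ)))) hK0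
        linarith
      · rcases max_choice (dA a b) (max ((u.map ℓ).sum : ℕ) ((v.map ℓ).sum : ℕ)) with h | h
        · rwa [h]
        · rw [h]
          rcases max_choice (((u.map ℓ).sum : ℕ) : ℝ) ((v.map ℓ).sum : ℕ) with h | h <;> rwa [h]
    · exact ⟨((u.map ℓ).sum : ℕ), by positivity, happ u l', htree' u l' l' fun _ => rfl⟩
    · refine ⟨((u.map ℓ).sum : ℕ), by positivity, ?_, ?_⟩
      · rw [← wordNorm_inv hS, mul_inv_rev, inv_inv]
        exact happ u l
      · rw [norm_sub_rev]
        exact htree' u l l fun _ => rfl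
  refine ⟨fun g => Φ (L g⁻¹), 2 * (K + C * K) + 3 * K * (K + c⁻¹) + 3 * K * K + 3 * K, ?_,
    fun g h => ⟨?_, ?_⟩⟩
  · have : 0 ≤ 2 * (K + C * K) + 3 * K * (K + c⁻¹) + 3 * K * K := by positivity
    linarith
  · refine (hupper g h).trans ?_
    have h1 : (0 : ℝ) ≤ wordDist S g h := NNReal.coe_nonneg _
    have h2 : 0 ≤ 3 * K * (K + c⁻¹) + 3 * K * K + 3 * K := by positivity
    have h3 : 0 ≤ 2 * (K + C * K) := by positivity
    nlinarith [mul_nonneg h2 h1]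
  · obtain ⟨M, hM, h1, h2⟩ := hlow (L g⁻¹) (L h⁻¹)
    have h3 : wordNorm S (g⁻¹ * h) ≤ 3 * K * M + 3 * K := by
      have h4 := hval g⁻¹
      have h5 := hval h⁻¹
      rw [← wordNorm_inv hS] at h5
      have h6 : g⁻¹ * h = g⁻¹ * ((L g⁻¹).map val).prod⁻¹ *
          (((L g⁻¹).map val).prod * ((L h⁻¹).map val).prod⁻¹) *
          (h⁻¹ * ((L h⁻¹).map val).prod⁻¹)⁻¹ := by group
      rw [h6]
      have h7 := wordNorm_mul_le hS (g⁻¹ * ((L g⁻¹).map val).prod⁻¹ *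
          (((L g⁻¹).map val).prod * ((L h⁻¹).map val).prod⁻¹))
          (h⁻¹ * ((L h⁻¹).map val).prod⁻¹)⁻¹
      have h8 := wordNorm_mul_le hS (g⁻¹ * ((L g⁻¹).map val).prod⁻¹)
          (((L g⁻¹).map val).prod * ((L h⁻¹).map val).prod⁻¹)
      linarith
    rw [wordDist_eq_wordNorm hS, dist_eq_norm]
    have h4 := rpow_le_of_le_affine (wordNorm_nonneg _) hM (by linarith : 1 ≤ 3 * K) hγ.le hγ1.le h3
    have h5 := mul_le_mul_of_nonneg_left h2 (by positivity : 0 ≤ 3 * K)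
    have h6 : 0 ≤ ‖Φ (L g⁻¹) - Φ (L h⁻¹)‖ := norm_nonneg _
    have h7 : 0 ≤ 2 * (K + C * K) + 3 * K * K + 3 * K := by positivity
    have h8 : 0 ≤ 2 * (K + C * K) + 3 * K * (K + c⁻¹) := by positivity
    nlinarith [mul_nonneg h7 h6]

/-- A homomorphism `f : G → Γ` is undistorted if normal forms as above admit a retraction, defined on
the last letters. -/
theorem exists_wordNorm_le_of_normalForm (hS : Subgroup.closure S = ⊤) {G : Type w} [Group G]
    {T : Set G} (hT : Subgroup.closure T = ⊤) {K : ℝ} (hK : 0 ≤ K) (f : G →* Γ)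
    (L : Γ → List A) (ρ : A → G) (R : A → A → Prop) (Q : A → Prop)
    (hL : ∀ x, ∀ s ∈ S, ∃ m, ListMove R Q (L x) m ∧ ListMove R Q m (L (s * x)))
    (hR : ∀ a b, R a b → wordNorm T (ρ a * (ρ b)⁻¹) ≤ K)
    (hQ : ∀ a, Q a → wordNorm T (ρ a) ≤ K)
    (hf : ∀ g, wordNorm T (g * (((L (f g)).getLast?.map ρ).getD 1)⁻¹) ≤ K) (g : G) :
    wordNorm T g ≤ 2 * K * wordNorm S (f g) + 2 * K := by
  let π : List A → G := fun l => (l.getLast?.map ρ).getD 1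
  -- A move at the beginning affects the last letter only if the tail is empty; the empty list is
  -- sent to `1`, so `hQ` covers pushing onto it and popping to it.
  have hmove : ∀ l l', ListMove R Q l l' → wordNorm T (π l * (π l')⁻¹) ≤ K := by
    intro l l' h
    cases h with
    | refl => simpa [wordNorm_one] using hK
    | @replace t a b h =>
      rcases t.eq_nil_or_concat with rfl | ⟨t, c, rfl⟩
      · simpa [π] using hR _ _ h
      · simpa [π, List.getLast?_cons, wordNorm_one] using hK
    | @push _ a h =>
      rcases l.eq_nil_or_concat with rfl | ⟨t, c, rfl⟩
      · simpa [π, wordNorm_inv hT] using hQ _ h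
      · simpa [π, List.getLast?_cons, wordNorm_one] using hK
    | @pop _ a h =>
      rcases l'.eq_nil_or_concat with rfl | ⟨t, c, rfl⟩
      · simpa [π] using hQ _ h
      · simpa [π, List.getLast?_cons, wordNorm_one] using hK
  have htri : ∀ a b c : G, wordNorm T (a * c⁻¹) ≤ wordNorm T (a * b⁻¹) + wordNorm T (b * c⁻¹) := by
    intro a b c
    simpa using wordNorm_mul_le hT (a * b⁻¹) (b * c⁻¹)
  have hsymm : ∀ a b : G, wordNorm T (a * b⁻¹) = wordNorm T (b * a⁻¹) := by
    intro a b
    rw [← wordNorm_inv hT]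
    simp
  have h1 := le_mul_wordDist hS (fun x y => wordNorm T (π (L x⁻¹) * (π (L y⁻¹))⁻¹)) (K := 2 * K)
    (fun x => by simp [wordNorm_one]) (fun x y => hsymm _ _) (fun x y z => htri _ _ _)
    (fun x s hs => by
      obtain ⟨m, h1, h2⟩ := hL (s⁻¹ * x⁻¹) s hs
      rw [mul_inv_cancel_left] at h2
      rw [mul_inv_rev, hsymm]
      linarith [htri (π (L (s⁻¹ * x⁻¹))) (π m) (π (L x⁻¹)), hmove _ _ h1, hmove _ _ h2])
    (f g)⁻¹ 1
  rw [wordDist_eq_wordNorm hS, inv_inv, mul_one, inv_one] at h1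
  have h2 := hf g
  have h3 := hf 1
  rw [map_one] at h3
  have h4 := htri g (π (L (f g))) 1
  have h5 := htri (π (L (f g))) (π (L 1)) 1
  rw [hsymm] at h3
  simp only [inv_one, mul_one] at h3 h4 h5
  change wordNorm T (g * (π (L (f g)))⁻¹) ≤ K at h2
  change wordNorm T (π (L 1)) ≤ K at h3
  linarith

end NormalForm

/-! ### Normal forms in amalgamated products -/

section Pushout

open Monoid Monoid.PushoutI

variable {ι : Type u} {G : ι → Type v} [∀ i, Group (G i)] {H : Type w} [Group H]
  {φ : ∀ i, H →* G i}

/-- The head splits as an element of the amalgamated subgroup times a coset representative `r`, and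
`r` is recorded as a letter unless it is trivial. -/
lemma pushout_toList_rcons [DecidableEq ι] [∀ i, DecidableEq (G i)] {d : NormalWord.Transversal φ}
    {i : ι} (p : NormalWord.Pair d i) : ∃ (h : H) (r : G i), p.head = φ i h * r ∧
      (r = 1 ∧ (NormalWord.rcons i p).toList = p.tail.toList ∨
        (NormalWord.rcons i p).toList = ⟨i, r⟩ :: p.tail.toList) := by
  obtain ⟨h, hh⟩ := ((d.compl i).equiv p.head).1.2
  refine ⟨h, ((d.compl i).equiv p.head).2, ?_, ?_⟩
  · rw [hh]
    exact ((d.compl i).equiv_fst_mul_equiv_snd p.head).symm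
  · simp only [NormalWord.rcons, CoprodI.Word.equivPair_symm, CoprodI.Word.rcons]
    split_ifs with h1
    · exact .inl ⟨h1, rfl⟩
    · exact .inr rfl

/-- Normal forms in amalgamated products. -/
lemma exists_pushout_normalForm (hφ : ∀ i, Function.Injective (φ i)) :
    ∃ L : PushoutI φ → List (Σ i, G i),
      (∀ x i (g : G i), ∃ (t : List (Σ i, G i)) (h h' : H) (r r' : G i),
        g * (φ i h * r) = φ i h' * r' ∧ (r = 1 ∧ L x = t ∨ L x = ⟨i, r⟩ :: t) ∧
        (r' = 1 ∧ L (of i g * x) = t ∨ L (of i g * x) = ⟨i, r'⟩ :: t)) ∧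
      (∀ x, ∃ h, x = base φ h * ((L x).map fun a => of a.1 a.2).prod) ∧
      ∀ i (g : G i), ∃ (h : H) (r : G i), g = φ i h * r ∧
        (r = 1 ∧ L (of i g) = [] ∨ L (of i g) = [⟨i, r⟩]) := by
  classical
  obtain ⟨d⟩ := NormalWord.transversal_nonempty φ hφ
  refine ⟨fun x => (x • (NormalWord.empty : NormalWord d)).toList, fun x i g => ?_, fun x => ?_,
    fun i g => ?_⟩
  · set w := x • (NormalWord.empty : NormalWord d)
    obtain ⟨h, r, h1, h2⟩ := pushout_toList_rcons (NormalWord.equivPair i w)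
    obtain ⟨h', r', h1', h2'⟩ := pushout_toList_rcons
      { NormalWord.equivPair i w with head := g * (NormalWord.equivPair i w).head }
    -- The forms of `x` and of its multiple by `g` share this tail, because the action of `g`
    -- changes only the head in factor `i`.
    refine ⟨(NormalWord.equivPair i w).tail.toList, h, h', r, r', ?_, ?_, ?_⟩
    · rw [← h1, ← h1']
    · have : NormalWord.rcons i (NormalWord.equivPair i w) = w :=
        (NormalWord.equivPair i).symm_apply_apply w
      rwa [this] at h2
    · beta_reduce
      rw [mul_smul, NormalWord.summand_smul_def]
      exact h2'
  · have h1 : (x • (NormalWord.empty : NormalWord d)).prod = x := by simp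
    refine ⟨(x • (NormalWord.empty : NormalWord d)).head, ?_⟩
    nth_rw 1 [← h1]
    rw [NormalWord.prod, CoprodI.Word.prod, map_list_prod, List.map_map]
    congr 2
  · by_cases hg : g ∈ (φ i).range
    · obtain ⟨h, rfl⟩ := hg
      refine ⟨h, 1, by simp, .inl ⟨rfl, ?_⟩⟩
      beta_reduce
      rw [of_apply_eq_base, NormalWord.base_smul_def]
      rfl
    · obtain ⟨h, hh⟩ := ((d.compl i).equiv g).1.2
      refine ⟨h, ((d.compl i).equiv g).2, ?_, .inr ?_⟩
      · rw [hh]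
        exact ((d.compl i).equiv_fst_mul_equiv_snd g).symm
      · have hne : (NormalWord.empty : NormalWord d).fstIdx ≠ some i := by
          simp [NormalWord.empty, CoprodI.Word.fstIdx]
        beta_reduce
        rw [← NormalWord.cons_eq_smul g _ hne hg, NormalWord.cons_toList]
        simp

variable {S : ∀ i, Set (G i)}

lemma iUnion_isFiniteGenerating [Finite ι] [Nonempty ι] (hS : ∀ i, IsFiniteGenerating (S i)) :
    IsFiniteGenerating (⋃ i, of (φ := φ) i '' S i) := by
  refine ⟨Set.finite_iUnion fun i => (hS i).1.image _, ?_⟩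
  have hof : ∀ i (g : G i), of (φ := φ) i g ∈ Subgroup.closure (⋃ i, of (φ := φ) i '' S i) := by
    intro i g
    have h1 : g ∈ Subgroup.closure (S i) := (hS i).2 ▸ Subgroup.mem_top g
    have h2 := Subgroup.mem_map_of_mem (of (φ := φ) i) h1
    rw [MonoidHom.map_closure] at h2
    exact Subgroup.closure_mono (Set.subset_iUnion (fun i => of (φ := φ) i '' S i) i) h2
  rw [eq_top_iff]
  intro x _
  induction x using PushoutI.induction_on with
  | of i g => exact hof i g
  | base h =>
    rw [← of_apply_eq_base φ (Classical.arbitrary ι)]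
    exact hof _ _
  | mul x y hx hy => exact mul_mem (hx trivial) (hy trivial)

lemma exists_bound_wordNorm_map [Finite ι] [Finite H] :
    ∃ M : ℝ, 0 ≤ M ∧ ∀ i h, wordNorm (S i) (φ i h) ≤ M := by
  obtain ⟨M, hM⟩ := Set.finite_range (fun x : ι × H => wordNorm (S x.1) (φ x.1 x.2)) |>.bddAbove
  exact ⟨max M 0, le_max_right _ _, fun i h => le_max_of_le_left (hM ⟨(i, h), rfl⟩)⟩

/-- Solving for `r * r'⁻¹` leaves a generator between two elements of the amalgamated subgroup,
whence `1` and `2 * M`. -/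
lemma wordNorm_mul_inv_le_of_base_mul (hS : ∀ i, IsFiniteGenerating (S i)) {M : ℝ}
    (hM : ∀ i h, wordNorm (S i) (φ i h) ≤ M) {i : ι} {g : G i} (hg : wordNorm (S i) g ≤ 1)
    {h h' : H} {r r' : G i} (heq : g * (φ i h * r) = φ i h' * r') :
    wordNorm (S i) (r * r'⁻¹) ≤ 2 * M + 1 := by
  have h1 : r * r'⁻¹ = (φ i h)⁻¹ * (g⁻¹ * φ i h') := by
    have h2 : r' = (φ i h')⁻¹ * (g * (φ i h * r)) := by rw [heq, inv_mul_cancel_left]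
    rw [h2]
    group
  rw [h1]
  have h2 := wordNorm_mul_le (hS i).2 (φ i h)⁻¹ (g⁻¹ * φ i h')
  have h3 := wordNorm_mul_le (hS i).2 g⁻¹ (φ i h')
  rw [wordNorm_inv (hS i).2] at h2 h3
  linarith [hM i h, hM i h']

lemma wordNorm_le_one_of_mem {G : Type u} [Group G] {S : Set G} {g : G} (hg : g ∈ S) :
    wordNorm S g ≤ 1 := by
  rw [wordNorm, wordDist, NNReal.coe_natCast]
  by_cases h : g = 1
  · simp [h]
  · have : (SimpleGraph.mulCayley S).Adj 1 g := by
      rw [SimpleGraph.mulCayley_adj]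
      exact ⟨Ne.symm h, .inl (by simpa using hg)⟩
    rw [SimpleGraph.dist_eq_one_iff_adj.2 this]
    simp

lemma listMove_of_pushout_normalForm (hS : ∀ i, IsFiniteGenerating (S i)) {M : ℝ}
    (hM : ∀ i h, wordNorm (S i) (φ i h) ≤ M) {L : PushoutI φ → List (Σ i, G i)}
    (hL : ∀ x i (g : G i), ∃ (t : List (Σ i, G i)) (h h' : H) (r r' : G i),
        g * (φ i h * r) = φ i h' * r' ∧ (r = 1 ∧ L x = t ∨ L x = ⟨i, r⟩ :: t) ∧
        (r' = 1 ∧ L (of i g * x) = t ∨ L (of i g * x) = ⟨i, r'⟩ :: t))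
    (x s : PushoutI φ) (hs : s ∈ ⋃ i, of (φ := φ) i '' S i) :
    ∃ m, ListMove (fun a b : Σ i, G i => ∃ i g g', a = ⟨i, g⟩ ∧ b = ⟨i, g'⟩ ∧
        wordNorm (S i) (g * g'⁻¹) ≤ 2 * M + 1) (fun a => wordNorm (S a.1) a.2 ≤ 2 * M + 1) (L x) m ∧
      ListMove (fun a b : Σ i, G i => ∃ i g g', a = ⟨i, g⟩ ∧ b = ⟨i, g'⟩ ∧
        wordNorm (S i) (g * g'⁻¹) ≤ 2 * M + 1) (fun a => wordNorm (S a.1) a.2 ≤ 2 * M + 1)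
        m (L (s * x)) := by
  obtain ⟨i, hs⟩ := Set.mem_iUnion.1 hs
  obtain ⟨g, hg, rfl⟩ := hs
  obtain ⟨t, h, h', r, r', heq, h1, h2⟩ := hL x i g
  have hr := wordNorm_mul_inv_le_of_base_mul hS hM (wordNorm_le_one_of_mem hg) heq
  refine ⟨_, ?_, .refl _⟩
  rcases h1 with ⟨rfl, h1⟩ | h1 <;> rcases h2 with ⟨rfl, h2⟩ | h2 <;> rw [h1, h2]
  · exact .refl _
  · exact .push _ (by simpa [wordNorm_inv (hS i).2] using hr)
  · exact .pop _ (by simpa using hr)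
  · exact .replace _ ⟨i, r, r', rfl, rfl, hr⟩

lemma exists_wordNorm_le_pushout [Finite ι] [Finite H]
    (hφ : ∀ i, Function.Injective (φ i)) (hS : ∀ i, IsFiniteGenerating (S i)) (i : ι) :
    ∃ K : ℝ, 1 ≤ K ∧ ∀ g : G i, wordNorm (S i) g ≤
      K * wordNorm (⋃ i, of (φ := φ) i '' S i) (of (φ := φ) i g) + K := by
  classical
  have : Nonempty ι := ⟨i⟩
  obtain ⟨M, hM0, hM⟩ := exists_bound_wordNorm_map (φ := φ) (S := S)
  obtain ⟨L, hL, -, hL2⟩ := exists_pushout_normalForm hφ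
  refine ⟨2 * (2 * M + 1), by linarith, ?_⟩
  -- The retraction keeps a last letter from factor `i` and sends letters of the other factors to
  -- `1`.
  refine exists_wordNorm_le_of_normalForm (iUnion_isFiniteGenerating hS).2 (hS i).2 (by linarith) _
    L (fun a => Pi.mulSingle a.1 a.2 i) _ _ (listMove_of_pushout_normalForm hS hM hL) ?_ ?_ ?_
  · rintro - - ⟨j, g, g', rfl, rfl, h⟩
    by_cases hj : i = j
    · subst hj
      simpa using h
    · simp only [Pi.mulSingle_eq_of_ne hj, inv_one, mul_one, wordNorm_one]
      linarith
  · rintro ⟨j, g⟩ h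
    by_cases hj : i = j
    · subst hj
      simpa using h
    · simp only [Pi.mulSingle_eq_of_ne hj, wordNorm_one]
      linarith
  · intro g
    obtain ⟨h, r, rfl, ⟨rfl, h1⟩ | h1⟩ := hL2 i g <;> rw [h1]
    · simp
      linarith [hM i h]
    · simp
      linarith [hM i h]

/-- The letters form a wedge of the factors, embedded with one copy of `ℕ` as coordinates for each
factor; `hasCompression_of_normalForm` then applies. -/
theorem hasCompression_pushout [Finite ι] [Nonempty ι] [Finite H] {p : ℝ≥0∞} [Fact (1 ≤ p)]
    (hp : p ≠ ∞) (hφ : ∀ i, Function.Injective (φ i)) (hS : ∀ i, IsFiniteGenerating (S i))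
    [∀ i, Countable (G i)] {γ : ℝ} (hγ : 0 < γ) (hγ1 : γ < 1)
    (h : ∀ i, HasCompression (wordDist (S i)) (lp (fun _ : ℕ => ℝ) p) γ) :
    HasCompression (wordDist (⋃ i, of (φ := φ) i '' S i)) (lp (fun _ : ℕ => ℝ) p) γ := by
  classical
  have hT := (iUnion_isFiniteGenerating (φ := φ) hS).2
  set T := ⋃ i, of (φ := φ) i '' S i
  obtain ⟨M, hM0, hM⟩ := exists_bound_wordNorm_map (φ := φ) (S := S)
  obtain ⟨L, hL, hL1, -⟩ := exists_pushout_normalForm hφ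
  choose f C hC hf using h
  choose C' hC' hf' using fun i => exists_wordNorm_map_le (hS i) hT (of (φ := φ) i)
  obtain ⟨N, hN⟩ := (Set.finite_range C).bddAbove
  obtain ⟨N', hN'⟩ := (Set.finite_range C').bddAbove
  obtain ⟨M', hM'⟩ := (Set.finite_range fun h : H => wordNorm T (base φ h)).bddAbove
  have hCN : ∀ i, C i ≤ N := fun i => hN ⟨i, rfl⟩
  have hCN' : ∀ i, C' i ≤ N' := fun i => hN' ⟨i, rfl⟩
  have hN1 : 1 ≤ N := (hC (Classical.arbitrary ι)).trans (hCN _)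
  have hN1' : 1 ≤ N' := (hC' (Classical.arbitrary ι)).trans (hCN' _)
  have hM0' : 0 ≤ M' := (wordNorm_nonneg _).trans (hM' ⟨1, rfl⟩)
  have hf1 : ∀ i (x y : G i), ‖f i x⁻¹ - f i y⁻¹‖ ≤ N * wordNorm (S i) (x * y⁻¹) + N := by
    intro i x y
    have h1 := (hf i x⁻¹ y⁻¹).1
    rw [dist_eq_norm, wordDist_eq_wordNorm (hS i).2, inv_inv] at h1
    exact h1.trans (add_le_add (mul_le_mul_of_nonneg_right (hCN i) (wordNorm_nonneg _)) (hCN i))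
  have hf2 : ∀ i (x y : G i), wordNorm (S i) (x * y⁻¹) ^ γ ≤ N * ‖f i x⁻¹ - f i y⁻¹‖ + N := by
    intro i x y
    have h1 := (hf i x⁻¹ y⁻¹).2
    rw [dist_eq_norm, wordDist_eq_wordNorm (hS i).2, inv_inv] at h1
    exact h1.trans (add_le_add (mul_le_mul_of_nonneg_right (hCN i) (norm_nonneg _)) (hCN i))
  have hf3 : ∀ i (x : G i), wordNorm T (of (φ := φ) i x) ≤ N' * wordNorm (S i) x := fun i x =>
    (hf' i x).trans (mul_le_mul_of_nonneg_right (hCN' i) (wordNorm_nonneg _))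
  let e : ∀ i : ι, ℕ ↪ ι × ℕ := fun i => ⟨fun n => (i, n), fun _ _ h => (Prod.ext_iff.1 h).2⟩
  -- Subtracting the value at `1` puts the base points of all factors at the origin, so short
  -- letters have bounded image. The inverse converts the left-invariant metric into `wordNorm (x *
  -- y⁻¹)`.
  let F : (Σ i, G i) → lp (fun _ : ι × ℕ => ℝ) p := fun a =>
    lpExtend hp (e a.1) (f a.1 a.2⁻¹ - f a.1 1)
  have hF : ∀ (a : Σ i, G i) (k : ι),
      lpComap hp (e k) (F a) = f k (Pi.mulSingle a.1 a.2 k)⁻¹ - f k 1 := by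
    rintro ⟨i, g⟩ k
    by_cases hk : k = i
    · subst hk
      simp only [F, lpComap_lpExtend, Pi.mulSingle_eq_same]
    · rw [lpComap_lpExtend_of_disjoint hp _ _ fun m n h => hk (Prod.ext_iff.1 h).1]
      simp [Pi.mulSingle_eq_of_ne hk]
  -- Letters are compared coordinatewise in the product of the factors. For letters of different
  -- factors the two relevant coordinates give their lengths, and the sum of these is at most twice
  -- the maximum.
  let D : (Σ i, G i) → (Σ i, G i) → ι → ℝ := fun a b k =>
    wordNorm (S k) (Pi.mulSingle a.1 a.2 k * (Pi.mulSingle b.1 b.2 k)⁻¹)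
  have hD : ∀ a b k, D a b k ^ γ ≤ N * ‖F a - F b‖ + N := by
    intro a b k
    refine (hf2 k _ _).trans ?_
    have h1 := norm_lpComap_le hp (e k) (F a - F b)
    rw [map_sub, hF, hF, sub_sub_sub_cancel_right] at h1
    nlinarith
  refine hasCompression_of_normalForm hT hp hγ hγ1
    (K := M' + 2 * N' + N * (2 * M + 1) + N + (2 * M + 1)) ?_ L
    (fun a => of a.1 a.2) (fun a => (SimpleGraph.mulCayley (S a.1)).dist 1 a.2) F
    (fun a b => max (D a b a.1) (D a b b.1)) _ _ (listMove_of_pushout_normalForm hS hM hL)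
    ?_ ?_ ?_ ?_ ?_ ?_ ?_
  · have : 0 ≤ N * (2 * M + 1) := by positivity
    linarith
  · rintro - - ⟨i, g, g', rfl, rfl, h⟩
    constructor
    · simp only [F]
      rw [← map_sub, norm_lpExtend, sub_sub_sub_cancel_right]
      have := hf1 i g g'
      nlinarith
    · change |wordNorm (S i) g - wordNorm (S i) g'| ≤ _
      have h1 := wordNorm_mul_le (hS i).2 (g * g'⁻¹) g'
      have h2 := wordNorm_mul_le (hS i).2 (g * g'⁻¹)⁻¹ g
      rw [wordNorm_inv (hS i).2] at h2
      simp only [inv_mul_cancel_right, mul_inv_rev, inv_inv] at h1 h2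
      have : 0 ≤ N * (2 * M + 1) := by positivity
      rw [abs_le]
      constructor <;> linarith
  · rintro ⟨i, g⟩ h
    constructor
    · simp only [F]
      rw [norm_lpExtend]
      have := hf1 i g 1
      simp only [inv_one, mul_one] at this
      simp only at h
      nlinarith
    · change wordNorm (S i) g ≤ _
      simp only at h
      have : 0 ≤ N * (2 * M + 1) := by positivity
      linarith
  · intro x
    obtain ⟨h, hx⟩ := hL1 x
    have h1 : x * ((L x).map fun a => of (φ := φ) a.1 a.2).prod⁻¹ = base φ h :=
      mul_inv_eq_of_eq_mul hx
    rw [h1]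
    have h2 : wordNorm T (base φ h) ≤ M' := hM' ⟨h, rfl⟩
    have : 0 ≤ N * (2 * M + 1) := by positivity
    linarith
  · rintro ⟨i, g⟩
    refine (hf3 i g).trans (mul_le_mul_of_nonneg_right ?_ (wordNorm_nonneg g))
    have : 0 ≤ N * (2 * M + 1) := by positivity
    linarith
  · intro a b
    exact le_max_of_le_left (wordNorm_nonneg _)
  · rintro ⟨i, g⟩ ⟨j, g'⟩
    have hK : 2 * N' ≤ M' + 2 * N' + N * (2 * M + 1) + N + (2 * M + 1) := by
      have : 0 ≤ N * (2 * M + 1) := by positivity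
      linarith
    have hmax : 0 ≤ max (D ⟨i, g⟩ ⟨j, g'⟩ i) (D ⟨i, g⟩ ⟨j, g'⟩ j) :=
      le_max_of_le_left (wordNorm_nonneg _)
    have key : wordNorm T (of (φ := φ) i g * (of (φ := φ) j g')⁻¹) ≤
        2 * N' * max (D ⟨i, g⟩ ⟨j, g'⟩ i) (D ⟨i, g⟩ ⟨j, g'⟩ j) := by
      by_cases hij : i = j
      · subst hij
        rw [← map_inv, ← map_mul]
        refine (hf3 i _).trans ?_
        have h1 : wordNorm (S i) (g * g'⁻¹) = D ⟨i, g⟩ ⟨i, g'⟩ i := by simp [D]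
        rw [max_self, ← h1]
        nlinarith [wordNorm_nonneg (S := S i) (g * g'⁻¹)]
      · refine (wordNorm_mul_le hT _ _).trans ?_
        rw [wordNorm_inv hT]
        have h1 : wordNorm (S i) g = D ⟨i, g⟩ ⟨j, g'⟩ i := by
          simp [D, Pi.mulSingle_eq_of_ne hij]
        have h2 : wordNorm (S j) g' = D ⟨i, g⟩ ⟨j, g'⟩ j := by
          simp [D, Pi.mulSingle_eq_of_ne (Ne.symm hij), wordNorm_inv (hS j).2]
        have h3 := hf3 i g
        have h4 := hf3 j g'
        rw [h1] at h3
        rw [h2] at h4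
        have h5 := le_max_left (D ⟨i, g⟩ ⟨j, g'⟩ i) (D ⟨i, g⟩ ⟨j, g'⟩ j)
        have h6 := le_max_right (D ⟨i, g⟩ ⟨j, g'⟩ i) (D ⟨i, g⟩ ⟨j, g'⟩ j)
        nlinarith
    refine key.trans ((mul_le_mul_of_nonneg_right hK hmax).trans ?_)
    linarith
  · intro a b
    have h1 : max (D a b a.1) (D a b b.1) ^ γ ≤ N * ‖F a - F b‖ + N := by
      rcases max_choice (D a b a.1) (D a b b.1) with h | h <;> rw [h] <;> exact hD _ _ _
    have h2 : 0 ≤ N * (2 * M + 1) := by positivity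
    have h3 : N ≤ M' + 2 * N' + N * (2 * M + 1) + N + (2 * M + 1) := by linarith
    exact h1.trans (add_le_add (mul_le_mul_of_nonneg_right h3 (norm_nonneg _)) h3)

end Pushout

/-! ### Normal forms in HNN extensions -/

section HNN

open HNNExtension

variable {G : Type u} [Group G] {A B : Subgroup G} {φ : A ≃* B}

/-- The element `t ^ u * g` (or `g` if there is no `u`) of the HNN extension. -/
def hnnLetter (φ : A ≃* B) (a : Option ℤˣ × G) : HNNExtension G A B φ :=
  (a.1.elim 1 fun u => t ^ (u : ℤ)) * of a.2

/-- Normal forms in HNN extensions. -/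
lemma exists_hnn_normalForm (φ : A ≃* B) :
    ∃ L : HNNExtension G A B φ → List (Option ℤˣ × G),
      (∀ x (g : G), ∃ h T, L x = (none, h) :: T ∧ L (of g * x) = (none, g * h) :: T) ∧
      (∀ x, ∃ a ∈ A, ∃ b ∈ B, ∃ g T,
        (L x = (none, a * g) :: T ∧ L (t * x) = (none, b) :: (some 1, g) :: T) ∨
        (L x = (none, a) :: (some (-1), g) :: T ∧ L (t * x) = (none, b * g) :: T)) ∧
      (∀ x, x = ((L x).map (hnnLetter φ)).prod) ∧
      ∀ g, L (of g) = [(none, g)] := by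
  obtain ⟨d⟩ := NormalWord.TransversalPair.nonempty G A B
  let N : NormalWord d → List (Option ℤˣ × G) := fun w =>
    (none, w.head) :: w.toList.map fun a => (some a.1, a.2)
  refine ⟨fun x => N (x • (NormalWord.empty : NormalWord d)), fun x g => ?_, fun x => ?_,
    fun x => ?_, fun g => ?_⟩
  · refine ⟨_, _, rfl, ?_⟩
    beta_reduce
    rw [mul_smul, NormalWord.of_smul_eq_smul]
    rfl
  · beta_reduce
    rw [mul_smul, NormalWord.t_smul_eq_unitsSMul]
    generalize x • (NormalWord.empty : NormalWord d) = w
    -- If `t` cancels, the head is some `a ∈ A` followed by `t⁻¹`, and `t * a * t⁻¹ = φ a` is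
    -- absorbed into the next letter. Otherwise the head is split by the transversal as `a * g`, and
    -- `t * a = φ a * t` creates a new letter.
    by_cases h : NormalWord.Cancels 1 w
    · cases w using NormalWord.consRecOn with
      | ofGroup g => simp [NormalWord.Cancels] at h
      | cons a u w h1 h2 =>
        have ha : a ∈ A := h.1
        have hu : u = -1 := by simpa [NormalWord.Cancels] using h.2
        subst hu
        refine ⟨a, ha, φ ⟨a, ha⟩, (φ ⟨a, ha⟩).2, w.head, w.toList.map fun a => (some a.1, a.2),
          .inr ⟨rfl, ?_⟩⟩
        rw [NormalWord.unitsSMul, dif_pos h]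
        rfl
    · refine ⟨((d.compl 1).equiv w.head).1, ((d.compl 1).equiv w.head).1.2,
        (NormalWord.unitsSMulGroup φ d 1 w.head).1, (NormalWord.unitsSMulGroup φ d 1 w.head).1.2,
        ((d.compl 1).equiv w.head).2, w.toList.map fun a => (some a.1, a.2), .inl ⟨?_, ?_⟩⟩
      · rw [(d.compl 1).equiv_fst_mul_equiv_snd]
      · rw [NormalWord.unitsSMul, dif_neg h]
        simp only [N, NormalWord.cons_head, NormalWord.cons_toList, List.map_cons,
          NormalWord.group_smul_head, NormalWord.group_smul_toList, inv_mul_cancel_right]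
        rfl
  · have h1 : (x • (NormalWord.empty : NormalWord d)).prod φ = x := by simp
    nth_rw 1 [← h1]
    simp only [N, NormalWord.ReducedWord.prod, List.map_cons, List.prod_cons, List.map_map]
    congr 1
  · beta_reduce
    rw [NormalWord.of_smul_eq_smul]
    simp [N]

variable {S : Set G}

lemma hnn_isFiniteGenerating (φ : A ≃* B) (hS : IsFiniteGenerating S) :
    IsFiniteGenerating (insert (t : HNNExtension G A B φ) (of '' S)) := by
  refine ⟨(hS.1.image _).insert _, ?_⟩
  rw [eq_top_iff]
  intro x _
  induction x using HNNExtension.induction_on with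
  | of g =>
    have h1 : g ∈ Subgroup.closure S := hS.2 ▸ Subgroup.mem_top g
    have h2 := Subgroup.mem_map_of_mem (of (φ := φ)) h1
    rw [MonoidHom.map_closure] at h2
    exact Subgroup.closure_mono (Set.subset_insert _ _) h2
  | t => exact Subgroup.subset_closure (Set.mem_insert _ _)
  | mul x y hx hy => exact mul_mem (hx trivial) (hy trivial)
  | inv x hx => exact inv_mem (hx trivial)

lemma exists_bound_wordNorm_of_mem [Finite A] [Finite B] :
    ∃ M : ℝ, 1 ≤ M ∧ (∀ a ∈ A, wordNorm S a ≤ M) ∧ ∀ b ∈ B, wordNorm S b ≤ M := by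
  obtain ⟨M, hM⟩ := (Set.finite_range fun a : A => wordNorm S (a : G)).bddAbove
  obtain ⟨M', hM'⟩ := (Set.finite_range fun b : B => wordNorm S (b : G)).bddAbove
  exact ⟨max 1 (max M M'), le_max_left _ _,
    fun a ha => le_max_of_le_right (le_max_of_le_left (hM ⟨⟨a, ha⟩, rfl⟩)),
    fun b hb => le_max_of_le_right (le_max_of_le_right (hM' ⟨⟨b, hb⟩, rfl⟩))⟩

lemma listMove_of_hnn_normalForm (hS : IsFiniteGenerating S) {M : ℝ} (hM1 : 1 ≤ M)
    (hA : ∀ a ∈ A, wordNorm S a ≤ M) (hB : ∀ b ∈ B, wordNorm S b ≤ M)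
    {L : HNNExtension G A B φ → List (Option ℤˣ × G)}
    (hL : ∀ x (g : G), ∃ h T, L x = (none, h) :: T ∧ L (of g * x) = (none, g * h) :: T)
    (hL' : ∀ x, ∃ a ∈ A, ∃ b ∈ B, ∃ g T,
        (L x = (none, a * g) :: T ∧ L (t * x) = (none, b) :: (some 1, g) :: T) ∨
        (L x = (none, a) :: (some (-1), g) :: T ∧ L (t * x) = (none, b * g) :: T))
    (x s : HNNExtension G A B φ) (hs : s ∈ insert (t : HNNExtension G A B φ) (of '' S)) :
    ∃ m, ListMove (fun a b => wordNorm S (a.2 * b.2⁻¹) ≤ M) (fun a => wordNorm S a.2 ≤ M)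
        (L x) m ∧
      ListMove (fun a b => wordNorm S (a.2 * b.2⁻¹) ≤ M) (fun a => wordNorm S a.2 ≤ M)
        m (L (s * x)) := by
  rcases hs with rfl | ⟨g, hg, rfl⟩
  -- The relation ignores the stable letter, so `(none, a * g)` may be replaced by `(some 1, g)`
  -- before `(none, b)` is pushed. Cancellation runs the other way. This is why two moves are
  -- allowed.
  · obtain ⟨a, ha, b, hb, g, T, ⟨h1, h2⟩ | ⟨h1, h2⟩⟩ := hL' x <;> rw [h1, h2]
    · exact ⟨(some 1, g) :: T, .replace _ (by simpa using hA a ha), .push _ (hB b hb)⟩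
    · exact ⟨(some (-1), g) :: T, .pop _ (hA a ha),
        .replace _ (by simpa [wordNorm_inv hS.2] using hB b hb)⟩
  · obtain ⟨h, T, h1, h2⟩ := hL x g
    rw [h1, h2]
    refine ⟨_, .replace _ ?_, .refl _⟩
    simpa [wordNorm_inv hS.2] using (wordNorm_le_one_of_mem hg).trans hM1

lemma exists_wordNorm_le_hnn [Finite A] [Finite B] (φ : A ≃* B) (hS : IsFiniteGenerating S) :
    ∃ K : ℝ, 1 ≤ K ∧ ∀ g : G, wordNorm S g ≤
      K * wordNorm (insert (t : HNNExtension G A B φ) (of '' S)) (of g) + K := by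
  obtain ⟨M, hM1, hA, hB⟩ := exists_bound_wordNorm_of_mem (A := A) (B := B) (S := S)
  obtain ⟨L, hL, hL', -, hL2⟩ := exists_hnn_normalForm φ
  refine ⟨2 * M, by linarith, ?_⟩
  refine exists_wordNorm_le_of_normalForm (hnn_isFiniteGenerating φ hS).2 hS.2 (by linarith) _
    L Prod.snd _ _ (listMove_of_hnn_normalForm hS hM1 hA hB hL hL') (fun _ _ h => h)
    (fun _ h => h) fun g => ?_
  rw [hL2]
  simp only [List.getLast?_singleton, Option.map_some, Option.getD_some, mul_inv_cancel,
    wordNorm_one]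
  linarith

/-- Letters are embedded through their component in `G`. Ignoring the powers of `t` changes the
distance of two letters by at most `2`, which the additive constant absorbs. -/
theorem hasCompression_hnn [Finite A] [Finite B] (φ : A ≃* B) {p : ℝ≥0∞} [Fact (1 ≤ p)]
    (hp : p ≠ ∞) (hS : IsFiniteGenerating S) [Countable G] {γ : ℝ} (hγ : 0 < γ) (hγ1 : γ < 1)
    (h : HasCompression (wordDist S) (lp (fun _ : ℕ => ℝ) p) γ) :
    HasCompression (wordDist (insert (t : HNNExtension G A B φ) (of '' S)))
      (lp (fun _ : ℕ => ℝ) p) γ := by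
  have hT := (hnn_isFiniteGenerating φ hS).2
  set T := insert (t : HNNExtension G A B φ) (of '' S)
  obtain ⟨M, hM1, hA, hB⟩ := exists_bound_wordNorm_of_mem (A := A) (B := B) (S := S)
  obtain ⟨L, hL, hL', hL1, -⟩ := exists_hnn_normalForm φ
  obtain ⟨f, C, hC, hf⟩ := h
  obtain ⟨C', hC', hf'⟩ := exists_wordNorm_map_le hS hT (of (φ := φ))
  have hf1 : ∀ x y : G, ‖f x⁻¹ - f y⁻¹‖ ≤ C * wordNorm S (x * y⁻¹) + C ∧
      wordNorm S (x * y⁻¹) ^ γ ≤ C * ‖f x⁻¹ - f y⁻¹‖ + C := by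
    intro x y
    have h1 := hf x⁻¹ y⁻¹
    rwa [dist_eq_norm, wordDist_eq_wordNorm hS.2, inv_inv] at h1
  have ht : ∀ o : Option ℤˣ,
      wordNorm T (o.elim 1 fun u => (t : HNNExtension G A B φ) ^ (u : ℤ)) ≤ 1 := by
    have ht1 : wordNorm T (t : HNNExtension G A B φ) ≤ 1 :=
      wordNorm_le_one_of_mem (Set.mem_insert _ _)
    rintro (_ | u)
    · simp [wordNorm_one]
    · rcases Int.units_eq_one_or u with rfl | rfl
      · simpa using ht1
      · simpa [wordNorm_inv hT] using ht1
  have hCM : 0 ≤ C * M := by positivity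
  -- The summand `+ 1` in the length of a letter pays for its power of `t`: a letter with trivial
  -- component in `G` may still have length one in the extension.
  refine hasCompression_of_normalForm hT hp hγ hγ1 (K := C' + C * M + C + M + 2) (by linarith) L
    (hnnLetter φ) (fun a => (SimpleGraph.mulCayley S).dist 1 a.2 + 1)
    (fun a => f a.2⁻¹ - f 1) (fun a b => wordNorm S (a.2 * b.2⁻¹)) _ _
    (listMove_of_hnn_normalForm hS hM1 hA hB hL hL') ?_ ?_ ?_ ?_ (fun _ _ => wordNorm_nonneg _)
    ?_ ?_
  · rintro ⟨_, g⟩ ⟨_, g'⟩ h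
    simp only at h
    constructor
    · rw [sub_sub_sub_cancel_right]
      have := (hf1 g g').1
      nlinarith
    · simp only [Nat.cast_add, Nat.cast_one, add_sub_add_right_eq_sub]
      change |wordNorm S g - wordNorm S g'| ≤ _
      have h1 := wordNorm_mul_le hS.2 (g * g'⁻¹) g'
      have h2 := wordNorm_mul_le hS.2 (g * g'⁻¹)⁻¹ g
      rw [wordNorm_inv hS.2] at h2
      simp only [inv_mul_cancel_right, mul_inv_rev, inv_inv] at h1 h2
      rw [abs_le]
      constructor <;> linarith
  · rintro ⟨_, g⟩ h
    simp only at h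
    constructor
    · have := (hf1 g 1).1
      simp only [inv_one, mul_one] at this
      nlinarith
    · simp only [Nat.cast_add, Nat.cast_one]
      change wordNorm S g + 1 ≤ _
      linarith
  · intro x
    rw [← hL1 x, mul_inv_cancel, wordNorm_one]
    linarith
  · rintro ⟨o, g⟩
    simp only [Nat.cast_add, Nat.cast_one, hnnLetter]
    change _ ≤ _ * (wordNorm S g + 1)
    refine (wordNorm_mul_le hT _ _).trans ?_
    have h1 := ht o
    have h2 := hf' g
    have h3 : 0 ≤ (C * M + C + M + 2) * wordNorm S g :=
      mul_nonneg (by linarith) (wordNorm_nonneg _)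
    nlinarith
  · rintro ⟨o, g⟩ ⟨o', g'⟩
    have h1 : hnnLetter φ (o, g) * (hnnLetter φ (o', g'))⁻¹ =
        (o.elim 1 fun u => t ^ (u : ℤ)) * of (g * g'⁻¹) * (o'.elim 1 fun u => t ^ (u : ℤ))⁻¹ := by
      simp only [hnnLetter, mul_inv_rev, map_mul, map_inv, mul_assoc]
    rw [h1]
    have h2 := wordNorm_mul_le hT ((o.elim 1 fun u => t ^ (u : ℤ)) * of (g * g'⁻¹))
      (o'.elim 1 fun u => (t : HNNExtension G A B φ) ^ (u : ℤ))⁻¹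
    have h3 := wordNorm_mul_le hT (o.elim 1 fun u => (t : HNNExtension G A B φ) ^ (u : ℤ))
      (of (g * g'⁻¹))
    rw [wordNorm_inv hT] at h2
    have h4 := ht o
    have h5 := ht o'
    have h6 := hf' (g * g'⁻¹)
    have h7 : 0 ≤ (C * M + C + M + 2) * wordNorm S (g * g'⁻¹) :=
      mul_nonneg (by linarith) (wordNorm_nonneg _)
    simp only
    nlinarith
  · rintro ⟨-, g⟩ ⟨-, g'⟩
    rw [sub_sub_sub_cancel_right]
    have h1 := (hf1 g g').2
    have h2 : 0 ≤ (C' + C * M + M + 2) * ‖f g⁻¹ - f g'⁻¹‖ :=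
      mul_nonneg (by linarith) (norm_nonneg _)
    simp only
    nlinarith

end HNN

/-! ### Compression exponents of amalgamated products and HNN extensions -/

lemma IsFiniteGenerating.fg {G : Type u} [Group G] {S : Set G} (hS : IsFiniteGenerating S) :
    Group.FG G :=
  Group.fg_iff.2 ⟨S, hS.2, hS.1⟩

lemma IsFiniteGenerating.countable {G : Type u} [Group G] {S : Set G} (hS : IsFiniteGenerating S) :
    Countable G := by
  obtain ⟨T, hT, f, hf⟩ := Group.fg_iff_exists_freeGroup_hom_surjective.1 hS.fg
  have : Countable T := hT.countable
  exact hf.countable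

lemma exists_isFiniteGenerating (G : Type u) [Group G] [Group.FG G] :
    ∃ S : Set G, IsFiniteGenerating S := by
  obtain ⟨S, h1, h2⟩ := Group.fg_iff.1 (inferInstance : Group.FG G)
  exact ⟨S, h2, h1⟩

/-- A homomorphism between finitely generated groups is automatically Lipschitz, so the lower bound
`h` makes `f` a quasi-isometric embedding, along which embeddings restrict. -/
lemma lpCompressionExponent_le_of_undistorted {G : Type u} {Γ : Type v} [Group G] [Group Γ]
    {S : Set G} {T : Set Γ} (p : ℝ≥0∞) [Fact (1 ≤ p)] (hS : IsFiniteGenerating S)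
    (hT : IsFiniteGenerating T) (f : G →* Γ) {K : ℝ} (hK : 1 ≤ K)
    (h : ∀ g, wordNorm S g ≤ K * wordNorm T (f g) + K) :
    lpCompressionExponent p T ≤ lpCompressionExponent p S := by
  obtain ⟨K', hK', h'⟩ := exists_wordNorm_map_le hS hT.2 f
  refine compressionExponent_mono f (K := K + K') (by linarith) (fun x y => ?_) (fun x y => ?_)
  · rw [wordDist_eq_wordNorm hS.2, wordDist_eq_wordNorm hT.2, ← map_inv, ← map_mul]
    have := h' (x⁻¹ * y)
    have := wordNorm_nonneg (S := S) (x⁻¹ * y)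
    nlinarith
  · rw [wordDist_eq_wordNorm hS.2, wordDist_eq_wordNorm hT.2, ← map_inv, ← map_mul]
    have := h (x⁻¹ * y)
    have := wordNorm_nonneg (S := T) (f (x⁻¹ * y))
    nlinarith

lemma le_compressionExponent_of_forall_lt {X : Type u} {dX : X → X → ℝ≥0} {Y : Type v}
    [MetricSpace Y] {c : ℝ} (hc : c ≤ 1)
    (h : ∀ γ, 0 < γ → γ < c → HasCompression dX Y γ) : c ≤ compressionExponent dX Y := by
  by_contra! hlt
  obtain ⟨γ, h1, h2⟩ := exists_between hlt
  have h0 : 0 < γ := (compressionExponent_nonneg _ _).trans_lt h1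
  exact absurd ((h γ h0 h2).le_compressionExponent h0 (h2.le.trans hc)) (not_le.2 h1)

section Main

variable (p : ℝ≥0∞) [Fact (1 ≤ p)]

/-- Generating sets of the two factors of an amalgamated product, as a family. -/
def amalgSet {G H : Type u} (SG : Set G) (SH : Set H) : ∀ b : Bool, Set (AmalgFactor G H b)
  | true => SG
  | false => SH

lemma isFiniteGenerating_amalgSet {G H : Type u} [Group G] [Group H] {SG : Set G} {SH : Set H}
    (hG : IsFiniteGenerating SG) (hH : IsFiniteGenerating SH) :
    ∀ b, IsFiniteGenerating (amalgSet SG SH b)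
  | true => hG
  | false => hH

lemma amalgMap_injective {G H : Type u} {F : Type v} [Group G] [Group H] [Group F] {i : F →* G}
    {j : F →* H} (hi : Function.Injective i) (hj : Function.Injective j) :
    ∀ b, Function.Injective (amalgMap i j b)
  | true => hi
  | false => hj

theorem lpCompressionExponent_amalgamatedProduct (hp : p ≠ ∞) {G H : Type u} {F : Type v} [Group G]
    [Group H] [Group F] [Finite F] {i : F →* G} {j : F →* H} (hi : Function.Injective i)
    (hj : Function.Injective j) {SG : Set G} {SH : Set H} {S : Set (AmalgamatedProduct i j)}
    (hG : IsFiniteGenerating SG) (hH : IsFiniteGenerating SH) (hS : IsFiniteGenerating S) :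
    lpCompressionExponent p S =
      min (lpCompressionExponent p SG) (lpCompressionExponent p SH) := by
  have hφ := amalgMap_injective hi hj
  have hgen := isFiniteGenerating_amalgSet hG hH
  have hT := iUnion_isFiniteGenerating (φ := amalgMap i j) hgen
  rw [lpCompressionExponent_eq p hS hT]
  apply le_antisymm
  · refine le_min ?_ ?_
    · obtain ⟨K, hK, h⟩ := exists_wordNorm_le_pushout hφ hgen true
      exact lpCompressionExponent_le_of_undistorted p (hgen true) hT _ hK h
    · obtain ⟨K, hK, h⟩ := exists_wordNorm_le_pushout hφ hgen false
      exact lpCompressionExponent_le_of_undistorted p (hgen false) hT _ hK h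
  -- A `γ` strictly below the minimum is attained by both factors and is also strictly below `1`, as
  -- the tree weights require.
  · refine le_compressionExponent_of_forall_lt
      ((min_le_left _ _).trans (compressionExponent_le_one _ _)) fun γ h0 h1 => ?_
    have hcount : ∀ b, Countable (AmalgFactor G H b) := fun b =>
      (hgen b).countable
    refine hasCompression_pushout hp hφ hgen h0
      (h1.trans_le ((min_le_left _ _).trans (compressionExponent_le_one _ _))) ?_
    rintro (_ | _)
    · exact .of_lt_compressionExponent h0.le (h1.trans_le (min_le_right _ _))
    · exact .of_lt_compressionExponent h0.le (h1.trans_le (min_le_left _ _))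

theorem lpCompressionExponent_hnnExtension (hp : p ≠ ∞) {G : Type u} [Group G] {F F' : Subgroup G}
    [Finite F] (θ : F ≃* F') {SG : Set G} {S : Set (HNNExtension G F F' θ)}
    (hG : IsFiniteGenerating SG) (hS : IsFiniteGenerating S) :
    lpCompressionExponent p S = lpCompressionExponent p SG := by
  have : Finite F' := .of_equiv F θ.toEquiv
  have hT := hnn_isFiniteGenerating θ hG
  rw [lpCompressionExponent_eq p hS hT]
  apply le_antisymm
  · obtain ⟨K, hK, h⟩ := exists_wordNorm_le_hnn θ hG
    exact lpCompressionExponent_le_of_undistorted p hG hT _ hK h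
  · refine le_compressionExponent_of_forall_lt (compressionExponent_le_one _ _) fun γ h0 h1 => ?_
    have := hG.countable
    exact hasCompression_hnn θ hp hG h0 (h1.trans_le (compressionExponent_le_one _ _))
      (.of_lt_compressionExponent h0.le h1)

end Main

theorem mainTheorem5 {G H : Type u} [Group G] [Group H] [Group.FG G] [Group.FG H]
    (p : ℝ≥0∞) [Fact (1 ≤ p)] (hp : p ≠ ∞) :
    -- amalgamated products over a finite group `F`
    (∀ {F : Type v} [Group F] [Finite F] (i : F →* G) (j : F →* H),
      Function.Injective i → Function.Injective j →
      Group.FG (AmalgamatedProduct i j) ∧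
      ∀ (SG : Set G) (SH : Set H) (S : Set (AmalgamatedProduct i j)),
        IsFiniteGenerating SG → IsFiniteGenerating SH → IsFiniteGenerating S →
        lpCompressionExponent p S =
          min (lpCompressionExponent p SG) (lpCompressionExponent p SH)) ∧
    -- HNN extensions of `G` with finite associated subgroups `F` and `θ(F) = F'`
    (∀ (F F' : Subgroup G) [Finite F] (θ : F ≃* F'),
      Group.FG (HNNExtension G F F' θ) ∧
      ∀ (SG : Set G) (S : Set (HNNExtension G F F' θ)),
        IsFiniteGenerating SG → IsFiniteGenerating S →
        lpCompressionExponent p S = lpCompressionExponent p SG) := by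
  refine ⟨fun {F} _ _ i j hi hj => ⟨?_, fun SG SH S hG hH hS =>
    lpCompressionExponent_amalgamatedProduct p hp hi hj hG hH hS⟩, fun F F' _ θ => ⟨?_,
    fun SG S hG hS => lpCompressionExponent_hnnExtension p hp θ hG hS⟩⟩
  · obtain ⟨SG, hG⟩ := exists_isFiniteGenerating G
    obtain ⟨SH, hH⟩ := exists_isFiniteGenerating H
    exact (iUnion_isFiniteGenerating (φ := amalgMap i j) (isFiniteGenerating_amalgSet hG hH)).fg
  · obtain ⟨SG, hG⟩ := exists_isFiniteGenerating G
    exact (hnn_isFiniteGenerating θ hG).fg
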